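/- Let $\lambda_b>0$, $\alpha>2$, and let $K,L\ge 1$ be integers. Suppose that the base stations (BSs) form a homogeneous Poisson point process (HPPP) of density $\lambda_b$ on the plane $\mathbb R^2$, and let $r_{0,1}\le r_{0,2}\le\cdots$ be the distances from the origin to the BSs in increasing order. Let $\mathbf P_K=L\sum_{i=1}^K r_{0,i}^{-\alpha}$. Let $\Gamma(s,q)=\int_q^\infty t^{s-1}e^{-t}\,dt$ ($s\in\mathbb R$, $q>0$) denote the upper incomplete gamma function, and for $0\le i\le K$ define $A_{i,0}=1$ and $$A_{i,j}=\frac1j\sum_{\ell=1}^{j}\bigl(\ell(i+1)-j\bigr)\,\frac{2}{\ell!\,(2-\ell\alpha)}\,A_{i,j-\ell}\qquad(j\ge 1).$$ Then $\mathbf P_K$ is a random variable, whose CDF is $$F_P(x)=P\Bigl(\sum_{i=1}^K r_{0,i}^{-\alpha}\le \frac xL\Bigr)\qquad(x\in\mathbb R),$$ where, for every $x>0$, $$\begin{aligned}P\Bigl(\sum_{i=1}^K r_{0,i}^{-\alpha}\le x\Bigr)={}&e^{-\lambda_b\pi(K/x)^{2/\alpha}}\sum_{\ell=0}^{K}\frac{\bigl(\lambda_b\pi(K/x)^{2/\alpha}\bigr)^\ell}{\ell!}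 +\frac1\pi\sum_{\ell=1}^{K}\binom K\ell\Bigl(-\Gamma\bigl(1-\tfrac2\alpha\bigr)\Bigr)^\ell\sin\Bigl(\frac{2\pi\ell}{\alpha}\Bigr)\\ &\times\sum_{m=0}^\infty A_{K-\ell,m}\,\Gamma\bigl(m+\tfrac2\alpha\ell\bigr)\,x^{-m-\frac2\alpha\ell}\,\frac1{K!}\,(\lambda_b\pi)^{\frac12 m\alpha+\ell}\,\Gamma\Bigl(K-\frac{m\alpha}2-\ell+1,\ \Bigl(\frac Kx\Bigr)^{2/\alpha}\lambda_b\pi\Bigr),\end{aligned}$$ each of the infinite series over $m$ being absolutely convergent, and $P\bigl(\sum_{i=1}^K r_{0,i}^{-\alpha}\le x\bigr)=0$ for $x\le 0$. -/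

import Mathlib

/-!
The numbers `λπr²`, for `r` the distances of the base stations, form a Poisson process of unit rate
on the half-line, and the law of its first `K + 1` points is determined by the counts in disjoint
intervals. Given the `(K + 1)`-st point `t`, the first `K` points are an independent uniform sample
on `(0, t)` put in order, so `∑ rᵢ ^ (-α)` is a multiple of a sum of `K` independent Pareto
variables with exponent `δ = 2 / α`, and it remains to average the distribution function of that
sum over the Erlang law of `t`.

The measure `z ^ (-δ - 1) dz` on `(1, ∞)` is the difference of the same measure on `(0, ∞)` and on
`(0, 1)`, which are finite near `0` only if `δ < 0`. In that case its `K`-fold convolution expands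
binomially into Beta integrals and powers of the series `∑ m, 2 / (m! (2 - mα)) X ^ m`. Both sides
of the resulting formula are analytic in `δ`, so it persists for `δ < 1`. The `A_{i,j}` are the
coefficients of the `i`-th power of that series: comparing coefficients in
`f (f ^ i)' = i f' f ^ i` gives the recursion. Integrating term by term against the Erlang density
yields the incomplete gamma functions.
-/

open MeasureTheory ProbabilityTheory

noncomputable section

namespace CoopBS

/-- The Euclidean plane in which the base stations are located. -/
abbrev Plane : Type := EuclideanSpace ℝ (Fin 2)

/-- `Φ` is a homogeneous Poisson point process of density `lam` on the plane: a random locally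
finite set of points such that the number of points in a bounded Borel set `B` is Poisson
distributed with mean `lam` times the area of `B`, and the numbers of points in pairwise disjoint
bounded Borel sets are independent. -/
structure IsHPPP {Ω : Type*} [MeasurableSpace Ω] (P : Measure Ω) (lam : ℝ)
    (Φ : Ω → Set Plane) : Prop where
  finite_inter : ∀ ω, ∀ B : Set Plane, Bornology.IsBounded B → (Φ ω ∩ B).Finite
  measurable_count : ∀ B : Set Plane, MeasurableSet B → Bornology.IsBounded B →
    Measurable (fun ω => (Φ ω ∩ B).ncard)
  map_count : ∀ B : Set Plane, MeasurableSet B → Bornology.IsBounded B →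
    P.map (fun ω => (Φ ω ∩ B).ncard) = poissonMeasure (lam * volume.real B).toNNReal
  indep_count : ∀ (n : ℕ) (B : Fin n → Set Plane), (∀ k, MeasurableSet (B k)) →
    (∀ k, Bornology.IsBounded (B k)) → Pairwise (fun k l => Disjoint (B k) (B l)) →
    iIndepFun (fun k ω => (Φ ω ∩ B k).ncard) P

/-- The distance from the origin to the `i`-th nearest point of `S` (`i = 1, 2, …`): the least
radius of a closed disk centred at the origin that contains at least `i` points of `S`. -/
def nearestDist (S : Set Plane) (i : ℕ) : ℝ :=
  sInf {r : ℝ | 0 ≤ r ∧ (i : ℕ∞) ≤ (S ∩ Metric.closedBall 0 r).encard}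

/-- `∑_{i ≤ K} r_{0,i}^{-α}`, with `r_{0,i}` the distance from the origin to the `i`-th nearest
point of `S`. -/
def pathLossSum (α : ℝ) (K : ℕ) (S : Set Plane) : ℝ :=
  ∑ i ∈ Finset.Icc 1 K, nearestDist S i ^ (-α)

/-- The total average power `P_K = L ∑_{i ≤ K} r_{0,i}^{-α}` received from the mobile at the origin
by the `K` nearest base stations, each of which has `L` antennas. -/
def receivedPower (α : ℝ) (L K : ℕ) (S : Set Plane) : ℝ :=
  (L : ℝ) * pathLossSum α K S

/-- The upper incomplete gamma function `Γ(s, q) = ∫_q^∞ t^{s-1} e^{-t} dt` (for `q > 0` and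
arbitrary real `s`). -/
def upperGamma (s q : ℝ) : ℝ :=
  ∫ t in Set.Ioi q, t ^ (s - 1) * Real.exp (-t)

/-- The coefficients `A_{i,j}`; see `coeffA_zero` and `coeffA_eq` for the recursion in its usual
form. -/
def coeffA (α : ℝ) (i : ℕ) : ℕ → ℝ
  | 0 => 1
  | j + 1 => 1 / ((j : ℝ) + 1) * ∑ l : Fin (j + 1),
      (((l : ℕ) + 1 : ℝ) * ((i : ℝ) + 1) - ((j : ℝ) + 1)) *
        (2 / ((((l : ℕ) + 1).factorial : ℝ) * (2 - ((l : ℕ) + 1 : ℝ) * α))) *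
        coeffA α i (j - (l : ℕ))
  termination_by j => j
  decreasing_by omega

theorem coeffA_zero (α : ℝ) (i : ℕ) : coeffA α i 0 = 1 := by
  rw [coeffA]

theorem coeffA_eq (α : ℝ) (i j : ℕ) (hj : 0 < j) :
    coeffA α i j = 1 / (j : ℝ) * ∑ l ∈ Finset.Icc 1 j,
      ((l : ℝ) * ((i : ℝ) + 1) - (j : ℝ)) * (2 / ((l.factorial : ℝ) * (2 - (l : ℝ) * α))) *
        coeffA α i (j - l) := by
  obtain ⟨j, rfl⟩ : ∃ k, j = k + 1 := ⟨j - 1, by omega⟩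
  rw [coeffA, Finset.sum_fin_eq_sum_range, ← Finset.Ico_add_one_right_eq_Icc,
    Finset.sum_Ico_eq_sum_range]
  push_cast
  congr 1
  refine Finset.sum_congr (by simp) fun l hl => ?_
  have hl' : l < j + 1 := by simpa using hl
  have e : j + 1 - (1 + l) = j - l := by omega
  rw [dif_pos hl', e, add_comm 1 l, add_comm (1 : ℝ) (l : ℝ)]

/-- The `m`-th term of the series attached to `ℓ` in the formula for the distribution function. -/
def cdfTerm (α lam : ℝ) (K : ℕ) (x : ℝ) (l m : ℕ) : ℝ :=
  coeffA α (K - l) m * Real.Gamma ((m : ℝ) + 2 / α * (l : ℝ)) *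
    x ^ (-(m : ℝ) - 2 / α * (l : ℝ)) * (1 / (K.factorial : ℝ)) *
    (lam * Real.pi) ^ (1 / 2 * (m : ℝ) * α + (l : ℝ)) *
    upperGamma ((K : ℝ) - (m : ℝ) * α / 2 - (l : ℝ) + 1)
      (((K : ℝ) / x) ^ (2 / α) * lam * Real.pi)

/-- The explicit expression for `P(∑_{i ≤ K} r_{0,i}^{-α} ≤ x)`, `x > 0`. -/
def cdfFormula (α lam : ℝ) (K : ℕ) (x : ℝ) : ℝ :=
  Real.exp (-(lam * Real.pi * ((K : ℝ) / x) ^ (2 / α))) *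
      ∑ l ∈ Finset.range (K + 1),
        (lam * Real.pi * ((K : ℝ) / x) ^ (2 / α)) ^ l / (l.factorial : ℝ) +
    1 / Real.pi * ∑ l ∈ Finset.Icc 1 K,
      (K.choose l : ℝ) * (-Real.Gamma (1 - 2 / α)) ^ l * Real.sin (2 * Real.pi * (l : ℝ) / α) *
        ∑' m : ℕ, cdfTerm α lam K x l m

end CoopBS

end

noncomputable section

namespace CoopBS

open Set Filter Finset.HasAntidiagonal
open scoped ENNReal Nat Real Topology

/-- The recursion `hT` says that `T i j l` behaves like `e ^ i * b ^ j * (b + e) ^ l`. -/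
theorem eq_sum_alternating_choose_of_pascal {R : Type*} [CommRing R] {T : ℕ → ℕ → ℕ → R}
    (hT : ∀ i j l, T i j (l + 1) = T i (j + 1) l + T (i + 1) j l) (i j l : ℕ) :
    T i j l = ∑ p ∈ antidiagonal i,
      (i.choose p.1 : R) * ((-1) ^ p.2 * T 0 (j + p.2) (l + p.1)) := by
  induction i generalizing j l with
  | zero => simp
  | succ i ih =>
    rw [Finset.sum_antidiagonal_choose_succ_mul fun a b => (-1) ^ b * T 0 (j + b) (l + a),
      ← sub_eq_of_eq_add' (hT i j l), ih j (l + 1), ih (j + 1) l, sub_eq_add_neg,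
      ← Finset.sum_neg_distrib, add_comm]
    refine congrArg₂ _ (Finset.sum_congr rfl fun p _ => ?_) (Finset.sum_congr rfl fun p hp => ?_)
    · rw [pow_succ, add_right_comm, add_assoc]
      ring
    · rw [← mem_antidiagonal.1 hp, Nat.choose_symm_add, add_right_comm l 1 p.1, add_assoc l]

/-- The `n`-fold convolution power of a measure. -/
def convPow {M : Type*} [AddMonoid M] [MeasurableSpace M] (μ : Measure M) : ℕ → Measure M
  | 0 => Measure.dirac 0
  | n + 1 => μ ∗ convPow μ n

section ConvPow

variable {M : Type*} [AddCommMonoid M] [MeasurableSpace M]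

@[simp]
theorem convPow_zero (μ : Measure M) : convPow μ 0 = Measure.dirac 0 := rfl

theorem convPow_succ (μ : Measure M) (n : ℕ) : convPow μ (n + 1) = μ ∗ convPow μ n := rfl

instance sFinite_convPow (μ : Measure M) [SFinite μ] : ∀ n, SFinite (convPow μ n)
  | 0 => by rw [convPow_zero]; infer_instance
  | n + 1 => by
    have := sFinite_convPow μ n
    rw [convPow_succ]
    infer_instance

theorem convPow_smul (μ : Measure M) [SFinite μ] (c : ℝ≥0∞) (n : ℕ) :
    convPow (c • μ) n = c ^ n • convPow μ n := by
  induction n with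
  | zero => simp
  | succ n ih =>
    rw [convPow_succ, convPow_succ, ih, Measure.conv_smul_left, Measure.conv_smul_right, smul_smul,
      pow_succ']

variable [MeasurableAdd₂ M]

instance isFiniteMeasure_convPow (μ : Measure M) [IsFiniteMeasure μ] (n : ℕ) :
    IsFiniteMeasure (convPow μ n) := by
  induction n with
  | zero => rw [convPow_zero]; infer_instance
  | succ n ih => rw [convPow_succ]; infer_instance

theorem ae_conv_of_ae_of_ae {μ ν : Measure M} [SFinite ν] {p q r : M → Prop}
    (hμ : ∀ᵐ x ∂μ, p x) (hν : ∀ᵐ y ∂ν, q y) (hpq : ∀ x y, p x → q y → r (x + y))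
    (hr : MeasurableSet {z | r z}) : ∀ᵐ z ∂(μ ∗ ν), r z := by
  rw [Measure.conv, ae_map_iff (by fun_prop) hr]
  refine (Measure.ae_prod_iff_ae_ae (p := fun z => r (z.1 + z.2)) (measurable_add hr)).2 ?_
  filter_upwards [hμ] with x hx
  filter_upwards [hν] with y hy using hpq x y hx hy

theorem conv_withDensity {μ ν : Measure M} [SFinite ν] {g : M → ℝ≥0∞}
    (hg : Measurable g) (hadd : ∀ x y, g (x + y) = g x * g y) :
    (μ.withDensity g) ∗ (ν.withDensity g) = (μ ∗ ν).withDensity g := by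
  refine Measure.ext_of_lintegral _ fun f hf => ?_
  rw [Measure.lintegral_conv hf, lintegral_withDensity_eq_lintegral_mul _ hg (by fun_prop),
    lintegral_withDensity_eq_lintegral_mul _ hg hf, Measure.lintegral_conv (by fun_prop)]
  refine lintegral_congr fun x => ?_
  simp only [Pi.mul_apply]
  rw [lintegral_withDensity_eq_lintegral_mul _ hg (by fun_prop),
    ← lintegral_const_mul _ (by fun_prop)]
  refine lintegral_congr fun y => ?_
  simp only [Pi.mul_apply, hadd, mul_assoc]

theorem convPow_withDensity (μ : Measure M) [SFinite μ] {g : M → ℝ≥0∞}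
    (hg : Measurable g) (h0 : g 0 = 1) (hadd : ∀ x y, g (x + y) = g x * g y) (n : ℕ) :
    convPow (μ.withDensity g) n = (convPow μ n).withDensity g := by
  induction n with
  | zero =>
    refine Measure.ext_of_lintegral _ fun f hf => ?_
    rw [convPow_zero, convPow_zero, lintegral_withDensity_eq_lintegral_mul _ hg hf,
      lintegral_dirac' _ hf, lintegral_dirac' _ (hg.mul hf), Pi.mul_apply, h0, one_mul]
  | succ n ih => rw [convPow_succ, convPow_succ, ih, conv_withDensity hg hadd]

theorem convPow_map {N : Type*} [AddCommMonoid N] [MeasurableSpace N] [MeasurableAdd₂ N]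
    (μ : Measure M) [SFinite μ] (L : M →+ N) (hL : Measurable L) (n : ℕ) :
    convPow (μ.map L) n = (convPow μ n).map L := by
  induction n with
  | zero => rw [convPow_zero, convPow_zero, Measure.map_dirac' hL, map_zero]
  | succ n ih => rw [convPow_succ, convPow_succ, ih, Measure.map_conv_addMonoidHom L hL]

theorem map_sum_pi {α : Type*} [MeasurableSpace α] (μ : Measure α) [SigmaFinite μ] {f : α → M}
    (hf : Measurable f) (n : ℕ) :
    (Measure.pi fun _ : Fin n => μ).map (fun v => ∑ i, f (v i)) = convPow (μ.map f) n := by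
  induction n with
  | zero =>
    simp [Measure.map_const]
  | succ n ih =>
    have hsum (k : ℕ) : Measurable fun v : Fin k → α => ∑ i, f (v i) := by fun_prop
    have hsplit := measurePreserving_piFinSuccAbove (fun _ : Fin (n + 1) => μ) 0
    rw [convPow_succ, ← ih, Measure.conv, Measure.map_prod_map _ _ hf (hsum n),
      Measure.map_map (by fun_prop) (by fun_prop), ← hsplit.map_eq,
      Measure.map_map (by fun_prop) hsplit.measurable]
    congr 1
    ext v
    simp [Fin.sum_univ_succ, MeasurableEquiv.piFinSuccAbove, Fin.tail]

end ConvPow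

theorem conv_Iic (μ ν : Measure ℝ) [SFinite ν] (y : ℝ) :
    (μ ∗ ν) (Iic y) = ∫⁻ x, ν (Iic (y - x)) ∂μ := by
  rw [Measure.conv, Measure.map_apply (by fun_prop) measurableSet_Iic,
    Measure.prod_apply (measurableSet_Iic.preimage (by fun_prop))]
  refine lintegral_congr fun x => congrArg ν ?_
  ext z
  simp [le_sub_iff_add_le']

theorem ae_convPow_natCast_mul_le {μ : Measure ℝ} [SFinite μ] {a : ℝ} (h : ∀ᵐ x ∂μ, a ≤ x)
    (n : ℕ) : ∀ᵐ w ∂(convPow μ n), n * a ≤ w := by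
  induction n with
  | zero => simp
  | succ n ih =>
    refine ae_conv_of_ae_of_ae h ih (fun x w hx hw => ?_) measurableSet_Ici
    push_cast
    linarith

theorem ae_convPow_le_natCast_mul {μ : Measure ℝ} [SFinite μ] {b : ℝ} (h : ∀ᵐ x ∂μ, x ≤ b)
    (n : ℕ) : ∀ᵐ w ∂(convPow μ n), w ≤ n * b := by
  induction n with
  | zero => simp
  | succ n ih =>
    refine ae_conv_of_ae_of_ae h ih (fun x w hx hw => ?_) measurableSet_Iic
    push_cast
    linarith

/-- A measure on the line that is carried by `[0, ∞)` and finite on the intervals `(-∞, y]`. These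
measures have finite distribution functions, and are closed under convolution. -/
class IsLocFiniteNonneg (μ : Measure ℝ) : Prop extends SFinite μ where
  ae_nonneg : ∀ᵐ x ∂μ, 0 ≤ x
  measure_Iic_lt_top : ∀ y, μ (Iic y) < ∞

namespace IsLocFiniteNonneg

variable {μ ν : Measure ℝ}

theorem measure_Iic_ne_top [IsLocFiniteNonneg μ] (y : ℝ) : μ (Iic y) ≠ ∞ :=
  (measure_Iic_lt_top y).ne

theorem measure_Iic_of_neg [IsLocFiniteNonneg μ] {y : ℝ} (hy : y < 0) : μ (Iic y) = 0 :=
  measure_mono_null (fun _ hx => not_le.2 (lt_of_le_of_lt hx hy)) (ae_iff.1 ae_nonneg)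

instance dirac_zero : IsLocFiniteNonneg (Measure.dirac 0) where
  ae_nonneg := by simp
  measure_Iic_lt_top _ := measure_lt_top _ _

instance add [IsLocFiniteNonneg μ] [IsLocFiniteNonneg ν] : IsLocFiniteNonneg (μ + ν) where
  ae_nonneg := ae_add_measure_iff.2 ⟨ae_nonneg, ae_nonneg⟩
  measure_Iic_lt_top y := ENNReal.add_lt_top.2 ⟨measure_Iic_lt_top y, measure_Iic_lt_top y⟩

instance conv [IsLocFiniteNonneg μ] [IsLocFiniteNonneg ν] : IsLocFiniteNonneg (μ ∗ ν) where
  ae_nonneg := ae_conv_of_ae_of_ae ae_nonneg ae_nonneg (fun _ _ => add_nonneg) measurableSet_Ici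
  measure_Iic_lt_top y := by
    rw [conv_Iic]
    calc ∫⁻ x, ν (Iic (y - x)) ∂μ ≤ ∫⁻ x, (Iic y).indicator (fun _ => ν (Iic y)) x ∂μ := by
          refine lintegral_mono_ae ?_
          filter_upwards [ae_nonneg (μ := μ)] with x hx
          by_cases hxy : x ≤ y
          · rw [indicator_of_mem (mem_Iic.2 hxy)]
            exact measure_mono (Iic_subset_Iic.2 (by linarith))
          · rw [measure_Iic_of_neg (by linarith)]
            exact zero_le
      _ = ν (Iic y) * μ (Iic y) := by
          rw [lintegral_indicator measurableSet_Iic, setLIntegral_const]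
      _ < ∞ := ENNReal.mul_lt_top (measure_Iic_lt_top y) (measure_Iic_lt_top y)

instance convPow [IsLocFiniteNonneg μ] (n : ℕ) : IsLocFiniteNonneg (CoopBS.convPow μ n) := by
  induction n with
  | zero => exact dirac_zero
  | succ n ih => exact conv

end IsLocFiniteNonneg

theorem measureReal_conv_Iic (μ ν : Measure ℝ) [IsLocFiniteNonneg ν] (y : ℝ) :
    (μ ∗ ν).real (Iic y) = ∫ x, ν.real (Iic (y - x)) ∂μ := by
  have hanti : Antitone fun x => ν (Iic (y - x)) := fun _ _ hab =>
    measure_mono (Iic_subset_Iic.2 (by linarith))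
  rw [measureReal_def, conv_Iic, ← integral_toReal hanti.measurable.aemeasurable
    (Eventually.of_forall fun _ => IsLocFiniteNonneg.measure_Iic_lt_top _)]
  rfl

/-- The binomial theorem for `e = (b + e) - b` in the convolution algebra, where the difference
itself is not available. -/
theorem measureReal_convPow_Iic_eq_sum (b e : Measure ℝ) [IsLocFiniteNonneg b]
    [IsLocFiniteNonneg e] (n : ℕ) (y : ℝ) :
    (convPow e n).real (Iic y) = ∑ p ∈ antidiagonal n, (n.choose p.1 : ℝ) * ((-1) ^ p.2 *
      (convPow b p.2 ∗ convPow (b + e) p.1).real (Iic y)) := by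
  let T (i j l : ℕ) : ℝ := (convPow e i ∗ (convPow b j ∗ convPow (b + e) l)).real (Iic y)
  have hT (i j l : ℕ) : T i j (l + 1) = T i (j + 1) l + T (i + 1) j l := by
    have hsplit : convPow b j ∗ convPow (b + e) (l + 1) =
        convPow b (j + 1) ∗ convPow (b + e) l + e ∗ (convPow b j ∗ convPow (b + e) l) := by
      rw [convPow_succ, convPow_succ, ← Measure.conv_assoc, ← Measure.conv_assoc,
        ← Measure.add_conv, Measure.conv_comm _ (b + e), Measure.add_conv]
    have hmeas : convPow e i ∗ (convPow b j ∗ convPow (b + e) (l + 1)) =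
        convPow e i ∗ (convPow b (j + 1) ∗ convPow (b + e) l) +
          convPow e (i + 1) ∗ (convPow b j ∗ convPow (b + e) l) := by
      rw [hsplit, Measure.conv_add, ← Measure.conv_assoc _ e, Measure.conv_comm _ e, convPow_succ e]
    simp only [T]
    rw [hmeas, measureReal_add_apply (IsLocFiniteNonneg.measure_Iic_ne_top y)
      (IsLocFiniteNonneg.measure_Iic_ne_top y)]
  simpa [T] using eq_sum_alternating_choose_of_pascal hT n 0 0

theorem add_pow_div_factorial {F : Type*} [Field F] [CharZero F] (x w : F) (m : ℕ) :
    (x + w) ^ m / m ! = ∑ p ∈ antidiagonal m, x ^ p.1 / p.1 ! * (w ^ p.2 / p.2 !) := by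
  rw [(Commute.all x w).add_pow', Finset.sum_div]
  refine Finset.sum_congr rfl fun p hp => ?_
  rw [← mem_antidiagonal.1 hp, nsmul_eq_mul, Nat.cast_add_choose]
  have : ((p.1 + p.2)! : F) ≠ 0 := Nat.cast_ne_zero.2 (Nat.factorial_ne_zero _)
  field_simp

section AscPochhammer

theorem ascPochhammer_eval_nonneg {s : ℝ} (hs : 0 ≤ s) (m : ℕ) :
    0 ≤ (ascPochhammer ℝ m).eval s := by
  induction m with
  | zero => simp
  | succ m ih =>
    rw [ascPochhammer_succ_eval]
    positivity

theorem ascPochhammer_eval_mono {s t : ℝ} (hs : 0 ≤ s) (hst : s ≤ t) (m : ℕ) :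
    (ascPochhammer ℝ m).eval s ≤ (ascPochhammer ℝ m).eval t := by
  induction m with
  | zero => simp
  | succ m ih =>
    have ht := ascPochhammer_eval_nonneg (hs.trans hst) m
    rw [ascPochhammer_succ_eval, ascPochhammer_succ_eval]
    gcongr

theorem norm_ascPochhammer_eval_le {R : Type*} [SeminormedRing R] [NormOneClass R] (s : R)
    (m : ℕ) : ‖(ascPochhammer R m).eval s‖ ≤ (ascPochhammer ℝ m).eval ‖s‖ := by
  induction m with
  | zero => simp
  | succ m ih =>
    have hfactor : ‖s + m‖ ≤ ‖s‖ + m :=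
      (norm_add_le _ _).trans (by simpa using Nat.norm_cast_le (α := R) m)
    have hnonneg := ascPochhammer_eval_nonneg (norm_nonneg s) m
    rw [ascPochhammer_succ_eval, ascPochhammer_succ_eval]
    exact (norm_mul_le _ _).trans (by gcongr)

theorem Gamma_natCast_add {s : ℝ} (hs : 0 < s) (m : ℕ) :
    Real.Gamma (m + s) = (ascPochhammer ℝ m).eval s * Real.Gamma s := by
  induction m with
  | zero => simp
  | succ m ih =>
    rw [ascPochhammer_succ_eval, Nat.cast_succ, add_right_comm, Real.Gamma_add_one (by positivity),
      ih]
    ring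

theorem choose_add_natCast_sub_one (s : ℝ) (m : ℕ) :
    Ring.choose (s + m - 1) m = (ascPochhammer ℝ m).eval s / m ! := by
  have hfact := Ring.factorial_nsmul_multichoose_eq_ascPochhammer s m
  rw [Polynomial.ascPochhammer_smeval_eq_eval, nsmul_eq_mul] at hfact
  rw [eq_div_iff (by positivity), ← hfact, Ring.choose, mul_comm]
  ring_nf

theorem hasSum_ascPochhammer_one_sub_rpow (s : ℝ) {x : ℝ} (hx : |x| < 1) :
    HasSum (fun m : ℕ => (ascPochhammer ℝ m).eval s / m ! * x ^ m) ((1 - x) ^ (-s)) := by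
  have h := (Real.one_div_one_sub_rpow_hasFPowerSeriesOnBall_zero s).hasSum (y := x)
    (by rw [← ENNReal.ofReal_one, Metric.eball_ofReal]; simpa using hx)
  rw [zero_add, one_div, ← Real.rpow_neg (by linarith [(abs_lt.1 hx).2])] at h
  simpa [choose_add_natCast_sub_one, mul_comm] using h

end AscPochhammer

section MomentSeries

/-- The exponential generating function `∑ m, (∫ w ^ m ∂μ) X ^ m / m !` of the moments of `μ`. -/
def momentSeries (μ : Measure ℝ) : PowerSeries ℝ :=
  PowerSeries.mk fun m => ∫ w, w ^ m / (m ! : ℝ) ∂μ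

variable {μ ν : Measure ℝ}

theorem integrable_pow_conv (hμ : ∀ m : ℕ, Integrable (fun w => w ^ m) μ)
    (hν : ∀ m : ℕ, Integrable (fun w => w ^ m) ν) (m : ℕ) :
    Integrable (fun w : ℝ => w ^ m) (μ ∗ ν) := by
  rw [Measure.conv, integrable_map_measure (by fun_prop) (by fun_prop)]
  simp only [Function.comp_def, add_pow]
  exact integrable_finsetSum _ fun k _ => ((hμ k).mul_prod (hν (m - k))).mul_const _

theorem momentSeries_conv [SFinite μ] [SFinite ν] (hμ : ∀ m : ℕ, Integrable (fun w => w ^ m) μ)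
    (hν : ∀ m : ℕ, Integrable (fun w => w ^ m) ν) :
    momentSeries (μ ∗ ν) = momentSeries μ * momentSeries ν := by
  ext m
  simp only [momentSeries, PowerSeries.coeff_mul, PowerSeries.coeff_mk]
  rw [Measure.conv, integral_map (by fun_prop) (by fun_prop)]
  simp only [add_pow_div_factorial]
  rw [integral_finsetSum _ fun p _ => ((hμ p.1).div_const _).mul_prod ((hν p.2).div_const _)]
  exact Finset.sum_congr rfl fun p _ =>
    integral_prod_mul (fun x => x ^ p.1 / (p.1 ! : ℝ)) fun w => w ^ p.2 / (p.2 ! : ℝ)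

theorem integrable_pow_convPow (hμ : ∀ m : ℕ, Integrable (fun w => w ^ m) μ) (n m : ℕ) :
    Integrable (fun w : ℝ => w ^ m) (convPow μ n) := by
  induction n generalizing m with
  | zero => exact integrable_dirac (by simp)
  | succ n ih => exact integrable_pow_conv hμ ih m

theorem momentSeries_convPow [SFinite μ] (hμ : ∀ m : ℕ, Integrable (fun w => w ^ m) μ) (n : ℕ) :
    momentSeries (convPow μ n) = momentSeries μ ^ n := by
  induction n with
  | zero =>
    ext m
    rw [momentSeries, PowerSeries.coeff_mk, convPow_zero, integral_dirac, pow_zero,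
      PowerSeries.coeff_one]
    rcases m with _ | m <;> simp
  | succ n ih =>
    rw [convPow_succ, momentSeries_conv hμ (integrable_pow_convPow hμ n), ih, pow_succ']

/-- The binomial series for `(1 - w / y) ^ (-s)`, integrated term by term. -/
theorem hasSum_integral_one_sub_div_rpow [IsFiniteMeasure ν] {a y : ℝ} (hν : ∀ᵐ w ∂ν, |w| ≤ a)
    (ha : 0 ≤ a) (hay : a < y) (s : ℝ) :
    HasSum (fun m : ℕ => (ascPochhammer ℝ m).eval s * PowerSeries.coeff m (momentSeries ν) *
      y⁻¹ ^ m) (∫ w, (1 - w / y) ^ (-s) ∂ν) := by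
  have hy : 0 < y := ha.trans_lt hay
  have hratio : a / y < 1 := (div_lt_one hy).2 hay
  let F (m : ℕ) (w : ℝ) : ℝ := (ascPochhammer ℝ m).eval s / m ! * (w / y) ^ m
  let B (m : ℕ) : ℝ := (ascPochhammer ℝ m).eval |s| / m ! * (a / y) ^ m
  have hbound (m : ℕ) : ∀ᵐ w ∂ν, ‖F m w‖ ≤ B m := by
    filter_upwards [hν] with w hw
    have hasc : ‖(ascPochhammer ℝ m).eval s‖ ≤ (ascPochhammer ℝ m).eval |s| :=
      norm_ascPochhammer_eval_le s m
    have hpos := (norm_nonneg _).trans hasc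
    rw [norm_mul, norm_div, norm_pow, norm_div, Real.norm_of_nonneg hy.le, Real.norm_natCast,
      Real.norm_eq_abs w]
    simp only [B]
    gcongr
  have hint (m : ℕ) : Integrable (F m) ν := .of_bound (by fun_prop) _ (hbound m)
  have hB : Summable B :=
    (hasSum_ascPochhammer_one_sub_rpow |s| (by rwa [abs_of_nonneg (by positivity)])).summable
  have hsum : Summable fun m => ∫ w, ‖F m w‖ ∂ν := by
    refine .of_nonneg_of_le (fun m => integral_nonneg fun _ => norm_nonneg _) (fun m => ?_)
      (hB.mul_left (ν.real univ))
    calc ∫ w, ‖F m w‖ ∂ν ≤ ∫ _, B m ∂ν :=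
          integral_mono_ae (hint m).norm (integrable_const _) (hbound m)
      _ = ν.real univ * B m := by rw [integral_const, smul_eq_mul]
  have hterm (m : ℕ) : ∫ w, F m w ∂ν = (ascPochhammer ℝ m).eval s *
      PowerSeries.coeff m (momentSeries ν) * y⁻¹ ^ m := by
    rw [momentSeries, PowerSeries.coeff_mk, ← integral_const_mul, ← integral_mul_const]
    refine integral_congr_ae (.of_forall fun w => ?_)
    simp only [F, div_pow, inv_pow]
    ring
  have hvalue : ∫ w, ∑' m, F m w ∂ν = ∫ w, (1 - w / y) ^ (-s) ∂ν := by
    refine integral_congr_ae ?_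
    filter_upwards [hν] with w hw
    refine (hasSum_ascPochhammer_one_sub_rpow s ?_).tsum_eq
    rw [abs_div, abs_of_pos hy, div_lt_one hy]
    exact hw.trans_lt hay
  simpa only [hterm, hvalue] using hasSum_integral_of_summable_integral_norm hint hsum

end MomentSeries

section PowMeasure

/-- The measure `z ^ (s - 1) dz` on the set `I`. -/
def powMeasure (I : Set ℝ) (s : ℝ) : Measure ℝ :=
  (volume.restrict I).withDensity fun z => ENNReal.ofReal (z ^ (s - 1))

instance sFinite_powMeasure (I : Set ℝ) (s : ℝ) : SFinite (powMeasure I s) := by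
  rw [powMeasure]
  infer_instance

theorem integral_powMeasure {I : Set ℝ} (hI : MeasurableSet I) (h0 : I ⊆ Ici 0) (s : ℝ)
    (f : ℝ → ℝ) : ∫ z, f z ∂(powMeasure I s) = ∫ z in I, z ^ (s - 1) * f z := by
  rw [powMeasure, integral_withDensity_eq_integral_toReal_smul (by fun_prop) (by simp)]
  refine setIntegral_congr_fun hI fun z hz => ?_
  simp only [smul_eq_mul, ENNReal.toReal_ofReal (Real.rpow_nonneg (h0 hz) _)]

theorem ae_mem_powMeasure {I : Set ℝ} (hI : MeasurableSet I) (s : ℝ) :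
    ∀ᵐ z ∂(powMeasure I s), z ∈ I :=
  (withDensity_absolutelyContinuous _ _).ae_le (ae_restrict_mem hI)

theorem isLocFiniteNonneg_powMeasure {I : Set ℝ} (hI : MeasurableSet I) (h0 : I ⊆ Ici 0) {s : ℝ}
    (hfin : ∀ y, 0 ≤ y → IntegrableOn (fun z : ℝ => z ^ (s - 1)) (Iic y ∩ I)) :
    IsLocFiniteNonneg (powMeasure I s) where
  ae_nonneg := (ae_mem_powMeasure hI s).mono fun _ hz => h0 hz
  measure_Iic_lt_top y := by
    calc powMeasure I s (Iic y) ≤ powMeasure I s (Iic (max y 0)) :=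
          measure_mono (Iic_subset_Iic.2 (le_max_left y 0))
      _ = ∫⁻ z in Iic (max y 0) ∩ I, ENNReal.ofReal (z ^ (s - 1)) := by
          rw [powMeasure, withDensity_apply _ measurableSet_Iic,
            Measure.restrict_restrict measurableSet_Iic]
      _ < ∞ := (hfin _ (le_max_right y 0)).lintegral_lt_top

theorem isLocFiniteNonneg_powMeasure_Ioi {s : ℝ} (hs : 0 < s) :
    IsLocFiniteNonneg (powMeasure (Ioi 0) s) := by
  refine isLocFiniteNonneg_powMeasure measurableSet_Ioi Ioi_subset_Ici_self fun y hy => ?_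
  rw [Iic_inter_Ioi, ← intervalIntegrable_iff_integrableOn_Ioc_of_le hy]
  exact intervalIntegral.intervalIntegrable_rpow' (by linarith)

theorem isLocFiniteNonneg_powMeasure_Ioo {s : ℝ} (hs : 0 < s) :
    IsLocFiniteNonneg (powMeasure (Ioo 0 1) s) := by
  refine isLocFiniteNonneg_powMeasure measurableSet_Ioo (fun x hx => hx.1.le) fun y _ => ?_
  refine IntegrableOn.mono_set (t := Ioo 0 1) ?_ inter_subset_right
  rw [← intervalIntegrable_iff_integrableOn_Ioo_of_le zero_le_one]
  exact intervalIntegral.intervalIntegrable_rpow' (by linarith)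

instance isLocFiniteNonneg_powMeasure_Ici (s : ℝ) : IsLocFiniteNonneg (powMeasure (Ici 1) s) := by
  refine isLocFiniteNonneg_powMeasure measurableSet_Ici (Ici_subset_Ici.2 zero_le_one) fun y _ => ?_
  rw [inter_comm, Ici_inter_Iic]
  exact ContinuousOn.integrableOn_Icc fun z hz =>
    (Real.continuousAt_rpow_const _ _ (.inl (by linarith [hz.1]))).continuousWithinAt

theorem powMeasure_Ioo_add_Ici (s : ℝ) :
    powMeasure (Ioo 0 1) s + powMeasure (Ici 1) s = powMeasure (Ioi 0) s := by
  have hdisj : Disjoint (Ioo (0 : ℝ) 1) (Ici 1) :=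
    disjoint_left.2 fun _ hx hx' => not_lt.2 hx' hx.2
  rw [powMeasure, powMeasure, powMeasure, ← withDensity_add_measure,
    ← Measure.restrict_union hdisj measurableSet_Ici, Ioo_union_Ici_eq_Ioi zero_lt_one]

theorem isFiniteMeasure_powMeasure_Ioo {s : ℝ} (hs : 0 < s) :
    IsFiniteMeasure (powMeasure (Ioo 0 1) s) := by
  have := isLocFiniteNonneg_powMeasure_Ioo hs
  have hae : univ =ᵐ[powMeasure (Ioo 0 1) s] Iic 1 := by
    filter_upwards [ae_mem_powMeasure measurableSet_Ioo s] with z hz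
    exact propext ⟨fun _ => hz.2.le, fun _ => trivial⟩
  exact ⟨measure_congr hae ▸ IsLocFiniteNonneg.measure_Iic_lt_top 1⟩

theorem integrable_pow_powMeasure_Ioo {s : ℝ} (hs : 0 < s) (m : ℕ) :
    Integrable (fun w : ℝ => w ^ m) (powMeasure (Ioo 0 1) s) := by
  have := isFiniteMeasure_powMeasure_Ioo hs
  refine .of_bound (by fun_prop) 1 ?_
  filter_upwards [ae_mem_powMeasure measurableSet_Ioo s] with w hw
  rw [norm_pow, Real.norm_of_nonneg hw.1.le]
  exact pow_le_one₀ hw.1.le hw.2.le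

theorem momentSeries_powMeasure_Ioo {s : ℝ} (hs : 0 < s) :
    momentSeries (powMeasure (Ioo 0 1) s) = PowerSeries.mk fun m => 1 / (m ! * (m + s)) := by
  ext m
  have hexp : 0 < (m : ℝ) + s := by positivity
  rw [momentSeries, PowerSeries.coeff_mk, PowerSeries.coeff_mk,
    integral_powMeasure measurableSet_Ioo fun x hx => hx.1.le]
  calc ∫ z in Ioo (0 : ℝ) 1, z ^ (s - 1) * (z ^ m / m !)
      = ∫ z in Ioo (0 : ℝ) 1, z ^ (m + s - 1) / m ! := by
        refine setIntegral_congr_fun measurableSet_Ioo fun z hz => ?_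
        rw [add_sub_assoc, Real.rpow_add hz.1, Real.rpow_natCast]
        ring
    _ = (∫ z in (0 : ℝ)..1, z ^ (m + s - 1)) / m ! := by
        rw [intervalIntegral.integral_of_le zero_le_one, integral_Ioc_eq_integral_Ioo,
          integral_div]
    _ = 1 / (m ! * (m + s)) := by
        rw [integral_rpow (.inl (by linarith)), sub_add_cancel, Real.one_rpow,
          Real.zero_rpow hexp.ne', sub_zero, div_div, mul_comm]

theorem integral_Ioo_rpow_mul_sub_rpow {s t y : ℝ} (hs : 0 < s) (ht : 0 < t) (hy : 0 < y) :
    ∫ x in Ioo 0 y, x ^ (s - 1) * (y - x) ^ (t - 1) =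
      y ^ (s + t - 1) * (Real.Gamma s * Real.Gamma t / Real.Gamma (s + t)) := by
  have h := Complex.betaIntegral_scaled (s : ℂ) t hy
  rw [Complex.betaIntegral_eq_Gamma_mul_div _ _ (by simpa) (by simpa),
    intervalIntegral.integral_of_le hy.le, integral_Ioc_eq_integral_Ioo, ← Complex.ofReal_add,
    Complex.Gamma_ofReal, Complex.Gamma_ofReal, Complex.Gamma_ofReal] at h
  have hint : ∫ x in Ioo 0 y, (x : ℂ) ^ ((s : ℂ) - 1) * ((y : ℂ) - x) ^ ((t : ℂ) - 1) =
      ((∫ x in Ioo 0 y, x ^ (s - 1) * (y - x) ^ (t - 1) : ℝ) : ℂ) := by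
    rw [← integral_complex_ofReal]
    refine setIntegral_congr_fun measurableSet_Ioo fun x hx => ?_
    simp [Complex.ofReal_cpow hx.1.le, Complex.ofReal_cpow (sub_nonneg.2 hx.2.le)]
  have hpow : (y : ℂ) ^ (((s + t : ℝ) : ℂ) - 1) = ((y ^ (s + t - 1) : ℝ) : ℂ) := by
    rw [Complex.ofReal_cpow hy.le]
    simp
  rw [hint, hpow] at h
  exact_mod_cast h

theorem measureReal_powMeasure_Ioi_conv_Iic {ν : Measure ℝ} [IsLocFiniteNonneg ν] (s y : ℝ) :
    (powMeasure (Ioi 0) s ∗ ν).real (Iic y) =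
      ∫ z in Ioo 0 y, z ^ (s - 1) * ν.real (Iic (y - z)) := by
  rw [measureReal_conv_Iic, integral_powMeasure measurableSet_Ioi Ioi_subset_Ici_self,
    ← integral_Ioc_eq_integral_Ioo]
  refine setIntegral_eq_of_subset_of_forall_sdiff_eq_zero measurableSet_Ioi Ioc_subset_Ioi_self
    fun z hz => ?_
  have hzy : y < z := lt_of_not_ge fun hle => hz.2 ⟨hz.1, hle⟩
  rw [measureReal_def, IsLocFiniteNonneg.measure_Iic_of_neg (by linarith), ENNReal.toReal_zero,
    mul_zero]

theorem measureReal_convPow_powMeasure_Ioi_Iic {s : ℝ} (hs : 0 < s) (l : ℕ) {y : ℝ} (hy : 0 < y) :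
    (convPow (powMeasure (Ioi 0) s) l).real (Iic y) =
      Real.Gamma s ^ l * y ^ (s * l) / Real.Gamma (s * l + 1) := by
  have := isLocFiniteNonneg_powMeasure_Ioi hs
  induction l generalizing y with
  | zero => simp [measureReal_def, hy.le]
  | succ l ih =>
    have hexp : 0 < s * l + 1 := by positivity
    calc (convPow (powMeasure (Ioi 0) s) (l + 1)).real (Iic y)
        = ∫ z in Ioo 0 y, z ^ (s - 1) * (convPow (powMeasure (Ioi 0) s) l).real (Iic (y - z)) :=
          measureReal_powMeasure_Ioi_conv_Iic s y
      _ = ∫ z in Ioo 0 y, Real.Gamma s ^ l / Real.Gamma (s * l + 1) *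
            (z ^ (s - 1) * (y - z) ^ (s * l + 1 - 1)) := by
          refine setIntegral_congr_fun measurableSet_Ioo fun z hz => ?_
          simp only [ih (sub_pos.2 hz.2), add_sub_cancel_right]
          ring
      _ = Real.Gamma s ^ (l + 1) * y ^ (s * (l + 1 : ℕ)) / Real.Gamma (s * (l + 1 : ℕ) + 1) := by
          have hΓ := (Real.Gamma_pos_of_pos hexp).ne'
          rw [integral_const_mul, integral_Ioo_rpow_mul_sub_rpow hs hexp hy,
            show s + (s * l + 1) = s * (l + 1 : ℕ) + 1 by push_cast; ring, add_sub_cancel_right]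
          field_simp
          rw [pow_succ]

theorem measureReal_convPow_Ioo_conv_convPow_Ioi_Iic {s : ℝ} (hs : 0 < s) (j l : ℕ) {y : ℝ}
    (hy : (j : ℝ) < y) :
    (convPow (powMeasure (Ioo 0 1) s) j ∗ convPow (powMeasure (Ioi 0) s) l).real (Iic y) =
      Real.Gamma s ^ l * y ^ (s * l) / Real.Gamma (s * l + 1) *
        ∑' m : ℕ, (ascPochhammer ℝ m).eval (-(s * l)) *
          PowerSeries.coeff m (momentSeries (powMeasure (Ioo 0 1) s) ^ j) * y⁻¹ ^ m := by
  have := isLocFiniteNonneg_powMeasure_Ioi hs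
  have := isFiniteMeasure_powMeasure_Ioo hs
  have hj : (0 : ℝ) ≤ j := Nat.cast_nonneg j
  have hy0 : 0 < y := hj.trans_lt hy
  have hmem := ae_mem_powMeasure measurableSet_Ioo s (I := Ioo 0 1)
  have hsupp : ∀ᵐ w ∂(convPow (powMeasure (Ioo 0 1) s) j), |w| ≤ (j : ℝ) := by
    filter_upwards [ae_convPow_natCast_mul_le (hmem.mono fun _ hz => hz.1.le) j,
      ae_convPow_le_natCast_mul (hmem.mono fun _ hz => hz.2.le) j] with w h0 h1
    exact abs_le.2 ⟨by linarith, by linarith⟩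
  have hseries := hasSum_integral_one_sub_div_rpow hsupp hj hy (-(s * l))
  rw [momentSeries_convPow (integrable_pow_powMeasure_Ioo hs), neg_neg] at hseries
  rw [measureReal_conv_Iic, hseries.tsum_eq, ← integral_const_mul]
  refine integral_congr_ae ?_
  filter_upwards [hsupp] with w hw
  have hwy : w < y := (le_abs_self w).trans_lt (hw.trans_lt hy)
  have hfactor : y - w = y * (1 - w / y) := by field_simp
  rw [measureReal_convPow_powMeasure_Ioi_Iic hs l (sub_pos.2 hwy), hfactor,
    Real.mul_rpow hy0.le (sub_nonneg.2 ((div_le_one hy0).2 hwy.le))]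
  ring

end PowMeasure

theorem norm_coeff_pow_le {R : Type*} [NormedRing R] [NormOneClass R] {f : PowerSeries R} {C : ℝ}
    (hf : ∀ k, ‖PowerSeries.coeff k f‖ ≤ C / k !) (j m : ℕ) :
    ‖PowerSeries.coeff m (f ^ j)‖ ≤ C ^ j * ((j : ℝ) ^ m / m !) := by
  have hC : 0 ≤ C := by simpa using (norm_nonneg _).trans (hf 0)
  induction j generalizing m with
  | zero =>
    rw [pow_zero, PowerSeries.coeff_one]
    rcases m with _ | m <;> simp
  | succ j ih =>
    rw [pow_succ', PowerSeries.coeff_mul, Nat.cast_succ, add_comm (j : ℝ) 1,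
      add_pow_div_factorial, Finset.mul_sum]
    refine norm_sum_le_of_le _ fun p _ => (norm_mul_le _ _).trans ?_
    calc _ ≤ C / p.1 ! * (C ^ j * ((j : ℝ) ^ p.2 / p.2 !)) := by
          gcongr
          exacts [hf _, ih _]
      _ = _ := by
          rw [one_pow]
          ring

section ParetoSeries

/-- The power series `1 + ∑ k ≥ 1, δ / (δ - k) * X ^ k / k !`. For `δ = -s < 0` it is `s` times the
exponential generating function of the moments of `z ^ (s - 1) dz` on `(0, 1)`. -/
def paretoSeries {F : Type*} [Field F] (δ : F) : PowerSeries F :=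
  PowerSeries.mk fun k => if k = 0 then 1 else δ / ((δ - k) * k !)

theorem coeff_zero_paretoSeries {F : Type*} [Field F] (δ : F) :
    PowerSeries.coeff 0 (paretoSeries δ) = 1 := by
  simp [paretoSeries]

theorem map_paretoSeries {F F' : Type*} [Field F] [Field F'] (g : F →+* F') (δ : F) :
    PowerSeries.map g (paretoSeries δ) = paretoSeries (g δ) := by
  ext k
  simp only [paretoSeries, PowerSeries.coeff_map, PowerSeries.coeff_mk]
  split_ifs <;> simp

theorem paretoSeries_neg {s : ℝ} (hs : 0 < s) :
    paretoSeries (-s) = PowerSeries.C s * momentSeries (powMeasure (Ioo 0 1) s) := by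
  ext k
  rw [momentSeries_powMeasure_Ioo hs, paretoSeries, PowerSeries.coeff_mk, PowerSeries.coeff_C_mul,
    PowerSeries.coeff_mk]
  split_ifs with hk
  · simp [hk, hs.ne']
  · have hexp : (k : ℝ) + s ≠ 0 := by positivity
    have hexp' : -s - (k : ℝ) ≠ 0 := fun h => hexp (by linarith)
    field_simp
    ring

variable {𝕜 : Type*} [RCLike 𝕜]

theorem le_norm_sub_natCast {η : ℝ} {δ : 𝕜} (hδ : RCLike.re δ ≤ 1 - η) {k : ℕ} (hk : k ≠ 0) :
    η ≤ ‖δ - k‖ := by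
  have hk' : (1 : ℝ) ≤ k := Nat.one_le_cast.2 (Nat.one_le_iff_ne_zero.2 hk)
  have hre := (neg_abs_le _).trans' (neg_le_neg (RCLike.abs_re_le_norm (δ - k)))
  rw [map_sub, RCLike.natCast_re] at hre
  linarith

theorem norm_coeff_paretoSeries_le {R η : ℝ} (hη : 0 < η) {δ : 𝕜} (hR : ‖δ‖ ≤ R)
    (hδ : RCLike.re δ ≤ 1 - η) (k : ℕ) :
    ‖PowerSeries.coeff k (paretoSeries δ)‖ ≤ max 1 (R / η) / k ! := by
  rw [paretoSeries, PowerSeries.coeff_mk]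
  split_ifs with hk
  · simp [hk]
  · rw [← div_div, norm_div, RCLike.norm_natCast, norm_div]
    gcongr
    exact le_max_of_le_right
      (div_le_div₀ ((norm_nonneg _).trans hR) hR hη (le_norm_sub_natCast hδ hk))

/-- The general term of `tailSum`. -/
def tailTerm (y δ : 𝕜) (j p m : ℕ) : 𝕜 :=
  (ascPochhammer 𝕜 m).eval (δ * p) * PowerSeries.coeff m (paretoSeries δ ^ j) * y⁻¹ ^ m

/-- The series expressing, up to a factor, the distribution function at `y` of the convolution of
`j` measures `z ^ (-δ - 1) dz` on `(0, 1)` and `p` measures `z ^ (-δ - 1) dz` on `(0, ∞)`, continued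
analytically from the negative exponents `δ` to all exponents with real part below one. -/
def tailSum (y δ : 𝕜) (j p : ℕ) : 𝕜 :=
  ∑' m : ℕ, tailTerm y δ j p m

theorem tailSum_zero (y δ : 𝕜) (j : ℕ) : tailSum y δ j 0 = 1 := by
  have hcoeff : PowerSeries.constantCoeff (paretoSeries δ) = 1 := by
    rw [← PowerSeries.coeff_zero_eq_constantCoeff_apply, coeff_zero_paretoSeries]
  rw [tailSum,
    tsum_eq_single 0 fun m hm => by simp [tailTerm, ascPochhammer_ne_zero_eval_zero _ hm]]
  simp [tailTerm, hcoeff]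

theorem ofReal_tailTerm (y δ : ℝ) (j p m : ℕ) :
    ((tailTerm y δ j p m : ℝ) : ℂ) = tailTerm (y : ℂ) δ j p m := by
  have hasc : (((ascPochhammer ℝ m).eval (δ * p) : ℝ) : ℂ) =
      (ascPochhammer ℂ m).eval ((δ : ℂ) * p) := by
    rw [← ascPochhammer_map Complex.ofRealHom, Polynomial.eval_map, ← Complex.ofRealHom_eq_coe,
      ← Polynomial.eval₂_at_apply]
    simp
  have hcoeff : ((PowerSeries.coeff m (paretoSeries δ ^ j) : ℝ) : ℂ) =
      PowerSeries.coeff m (paretoSeries (δ : ℂ) ^ j) := by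
    rw [← Complex.ofRealHom_eq_coe, ← PowerSeries.coeff_map, map_pow, map_paretoSeries,
      Complex.ofRealHom_eq_coe]
  rw [tailTerm, tailTerm, Complex.ofReal_mul, Complex.ofReal_mul, hasc, hcoeff, Complex.ofReal_pow,
    Complex.ofReal_inv]

theorem ofReal_tailSum (y δ : ℝ) (j p : ℕ) :
    ((tailSum y δ j p : ℝ) : ℂ) = tailSum (y : ℂ) δ j p := by
  simp only [tailSum, Complex.ofReal_tsum, ofReal_tailTerm]

theorem norm_tailTerm_le {R η : ℝ} (hη : 0 < η) {δ : 𝕜} (hR : ‖δ‖ ≤ R)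
    (hδ : RCLike.re δ ≤ 1 - η) (y : 𝕜) (j p m : ℕ) :
    ‖tailTerm y δ j p m‖ ≤
      max 1 (R / η) ^ j * ((ascPochhammer ℝ m).eval (R * p) / m ! * (j / ‖y‖) ^ m) := by
  have hR0 : 0 ≤ R * p := mul_nonneg ((norm_nonneg _).trans hR) p.cast_nonneg
  have hasc : ‖(ascPochhammer 𝕜 m).eval (δ * p)‖ ≤ (ascPochhammer ℝ m).eval (R * p) := by
    refine (norm_ascPochhammer_eval_le _ _).trans (ascPochhammer_eval_mono (norm_nonneg _) ?_ m)
    rw [norm_mul, RCLike.norm_natCast]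
    gcongr
  have hcoeff := norm_coeff_pow_le (norm_coeff_paretoSeries_le hη hR hδ) j m
  rw [tailTerm, norm_mul, norm_mul, norm_pow, norm_inv]
  calc _ ≤ (ascPochhammer ℝ m).eval (R * p) * (max 1 (R / η) ^ j * ((j : ℝ) ^ m / m !)) *
          ‖y‖⁻¹ ^ m := by
        have hpos := ascPochhammer_eval_nonneg hR0 m
        gcongr
    _ = _ := by
        rw [div_pow, inv_pow]
        ring

theorem summable_tailTerm_bound (C c : ℝ) {j : ℕ} {y : 𝕜} (hy : (j : ℝ) < ‖y‖) :
    Summable fun m : ℕ => C * ((ascPochhammer ℝ m).eval c / m ! * (j / ‖y‖) ^ m) := by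
  have hratio : (j : ℝ) / ‖y‖ < 1 := (div_lt_one (j.cast_nonneg.trans_lt hy)).2 hy
  exact (hasSum_ascPochhammer_one_sub_rpow c
    (by rwa [abs_of_nonneg (by positivity)])).summable.mul_left C

theorem summable_norm_tailTerm {δ : 𝕜} (hδ : RCLike.re δ < 1) {y : 𝕜} {j : ℕ}
    (hy : (j : ℝ) < ‖y‖) (p : ℕ) : Summable fun m => ‖tailTerm y δ j p m‖ :=
  .of_nonneg_of_le (fun _ => norm_nonneg _)
    (norm_tailTerm_le (sub_pos.2 hδ) le_rfl (sub_sub_cancel _ _).ge y j p)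
    (summable_tailTerm_bound _ _ hy)

/-- The binomial expansion of `δ ^ K` times the distribution function at `y` of the `K`-fold
convolution power of `z ^ (-δ - 1) dz` on `[1, ∞)`, around `z ^ (-δ - 1) dz` on `(0, ∞)`. -/
def paretoFormula (K : ℕ) (y δ : ℝ) : ℝ :=
  ∑ p ∈ antidiagonal K, (K.choose p.1 : ℝ) * (-Real.Gamma (1 - δ)) ^ p.1 * y ^ (-(δ * p.1)) *
    (Real.Gamma (1 - δ * p.1))⁻¹ * tailSum y δ p.2 p.1

/-- The extension of `paretoFormula` to complex exponents. -/
def complexParetoFormula (K : ℕ) (y : ℝ) (δ : ℂ) : ℂ :=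
  ∑ p ∈ antidiagonal K, (K.choose p.1 : ℂ) * (-Complex.Gamma (1 - δ)) ^ p.1 *
    (y : ℂ) ^ (-(δ * p.1)) * (Complex.Gamma (1 - δ * p.1))⁻¹ * tailSum (y : ℂ) δ p.2 p.1

theorem ofReal_paretoFormula (K : ℕ) {y : ℝ} (hy : 0 ≤ y) (δ : ℝ) :
    ((paretoFormula K y δ : ℝ) : ℂ) = complexParetoFormula K y δ := by
  simp only [paretoFormula, complexParetoFormula]
  push_cast [ofReal_tailSum, Complex.ofReal_cpow hy, ← Complex.Gamma_ofReal]
  rfl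

theorem tailSum_neg {s : ℝ} (hs : 0 < s) (y : ℝ) (j p : ℕ) :
    tailSum y (-s) j p = s ^ j * ∑' m : ℕ, (ascPochhammer ℝ m).eval (-(s * p)) *
      PowerSeries.coeff m (momentSeries (powMeasure (Ioo 0 1) s) ^ j) * y⁻¹ ^ m := by
  rw [tailSum, ← tsum_mul_left]
  refine tsum_congr fun m => ?_
  rw [tailTerm, paretoSeries_neg hs, mul_pow, ← map_pow, PowerSeries.coeff_C_mul, neg_mul]
  ring

theorem pow_mul_measureReal_convPow_powMeasure_Ici_of_neg {δ : ℝ} (hδ : δ < 0) {K : ℕ} {y : ℝ}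
    (hy : (K : ℝ) < y) :
    δ ^ K * (convPow (powMeasure (Ici 1) (-δ)) K).real (Iic y) = paretoFormula K y δ := by
  obtain ⟨s, rfl⟩ : ∃ s, δ = -s := ⟨-δ, (neg_neg δ).symm⟩
  have hs : 0 < s := neg_lt_zero.1 hδ
  have := isLocFiniteNonneg_powMeasure_Ioo hs
  rw [neg_neg, measureReal_convPow_Iic_eq_sum (powMeasure (Ioo 0 1) s), powMeasure_Ioo_add_Ici,
    paretoFormula, Finset.mul_sum]
  refine Finset.sum_congr rfl fun p hp => ?_
  have hK : p.1 + p.2 = K := mem_antidiagonal.1 hp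
  have hp2 : (p.2 : ℝ) < y := lt_of_le_of_lt (Nat.cast_le.2 (by omega)) hy
  have hΓ : Real.Gamma (1 - -s) = s * Real.Gamma s := by
    rw [sub_neg_eq_add, add_comm, Real.Gamma_add_one hs.ne']
  have hsign : (-s) ^ p.2 * (-1) ^ p.2 = s ^ p.2 := by rw [← mul_pow, neg_mul_neg, mul_one]
  have hpow : (-(s * Real.Gamma s)) ^ p.1 = (-s) ^ p.1 * Real.Gamma s ^ p.1 := by
    rw [neg_mul_eq_neg_mul, mul_pow]
  have hexp : -(-s * p.1) = s * p.1 := by ring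
  have hexp' : 1 - -s * p.1 = s * p.1 + 1 := by ring
  rw [measureReal_convPow_Ioo_conv_convPow_Ioi_Iic hs _ _ hp2, tailSum_neg hs, hΓ, ← hK, pow_add,
    hpow, hexp, hexp', ← hsign]
  ring

end ParetoSeries

section Differentiability

theorem differentiableAt_coeff_paretoSeries_pow (j m : ℕ) {δ : ℂ} (hδ : δ.re < 1) :
    DifferentiableAt ℂ (fun δ : ℂ => PowerSeries.coeff m (paretoSeries δ ^ j)) δ := by
  induction j generalizing m with
  | zero => simp
  | succ j ih =>
    simp only [pow_succ', PowerSeries.coeff_mul]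
    refine .fun_sum fun p _ => .mul ?_ (ih _)
    simp only [paretoSeries, PowerSeries.coeff_mk]
    split_ifs with hk
    · fun_prop
    · have hsub : δ - p.1 ≠ 0 := norm_pos_iff.1 <|
        (sub_pos.2 hδ).trans_le
          (le_norm_sub_natCast (η := 1 - δ.re) (sub_sub_cancel 1 δ.re).ge hk)
      have hfact : (p.1 ! : ℂ) ≠ 0 := Nat.cast_ne_zero.2 (Nat.factorial_ne_zero _)
      exact .div (by fun_prop) (by fun_prop) (mul_ne_zero hsub hfact)

theorem differentiableAt_tailTerm (y : ℂ) (j p m : ℕ) {δ : ℂ} (hδ : δ.re < 1) :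
    DifferentiableAt ℂ (fun δ => tailTerm y δ j p m) δ := by
  have hasc : DifferentiableAt ℂ (fun δ : ℂ => (ascPochhammer ℂ m).eval (δ * p)) δ :=
    (ascPochhammer ℂ m).differentiableAt.comp δ (by fun_prop)
  exact (hasc.mul (differentiableAt_coeff_paretoSeries_pow j m hδ)).mul_const _

theorem differentiableAt_tailSum {y : ℂ} {j : ℕ} (hy : (j : ℝ) < ‖y‖) (p : ℕ) {δ : ℂ}
    (hδ : δ.re < 1) : DifferentiableAt ℂ (fun δ => tailSum y δ j p) δ := by
  obtain ⟨r, hδr, hr⟩ := exists_between hδ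
  let U : Set ℂ := {z | ‖z‖ < ‖δ‖ + 1 ∧ z.re < r}
  have hU : IsOpen U := (isOpen_lt continuous_norm continuous_const).inter
    (isOpen_lt Complex.continuous_re continuous_const)
  have hδU : δ ∈ U := ⟨lt_add_one _, hδr⟩
  refine DifferentiableOn.differentiableAt (s := U) ?_ (hU.mem_nhds hδU)
  exact Complex.differentiableOn_tsum_of_summable_norm (summable_tailTerm_bound _ _ hy)
    (fun m z hz => (differentiableAt_tailTerm y j p m (hz.2.trans hr)).differentiableWithinAt) hU
    fun m z hz => norm_tailTerm_le (sub_pos.2 hr) hz.1.le (hz.2.le.trans (sub_sub_cancel _ _).ge)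
      y j p m

theorem differentiableAt_complexParetoFormula {K : ℕ} {y : ℝ} (hy : (K : ℝ) < y) {δ : ℂ}
    (hδ : δ.re < 1) : DifferentiableAt ℂ (complexParetoFormula K y) δ := by
  have hy0 : 0 < y := K.cast_nonneg.trans_lt hy
  have hΓ : DifferentiableAt ℂ (fun δ : ℂ => Complex.Gamma (1 - δ)) δ := by
    refine (Complex.differentiableAt_Gamma _ fun m hm => ?_).comp δ (by fun_prop)
    have hre : 1 - δ.re = -m := by simpa using congrArg Complex.re hm
    linarith [m.cast_nonneg (α := ℝ)]
  refine .fun_sum fun p hp => ?_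
  have hp2 : (p.2 : ℝ) < ‖(y : ℂ)‖ := by
    rw [Complex.norm_of_nonneg hy0.le]
    exact lt_of_le_of_lt (Nat.cast_le.2 (antidiagonal.snd_le hp)) hy
  have hcpow : DifferentiableAt ℂ (fun δ : ℂ => (y : ℂ) ^ (-(δ * p.1))) δ :=
    .const_cpow (by fun_prop) (.inl (Complex.ofReal_ne_zero.2 hy0.ne'))
  have hΓinv : DifferentiableAt ℂ (fun δ : ℂ => (Complex.Gamma (1 - δ * p.1))⁻¹) δ :=
    (Complex.differentiable_one_div_Gamma _).comp δ (by fun_prop)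
  exact ((((hΓ.neg.pow p.1).const_mul _).mul hcpow).mul hΓinv).mul
    (differentiableAt_tailSum hp2 p.1 hδ)

end Differentiability

section AnalyticContinuation

/-- Lebesgue measure on `[1, ∞)`, transported to the graph of the logarithm. Keeping track of the
logarithm turns the density `z ^ (s - 1)` into an exponential, which commutes with convolution. -/
def logGraph : Measure (ℝ × ℝ) :=
  (volume.restrict (Ici (1 : ℝ))).map fun z => (z, Real.log z)

instance sFinite_logGraph : SFinite logGraph := by
  rw [logGraph]
  infer_instance

theorem powMeasure_Ici_eq_map_logGraph (s : ℝ) : powMeasure (Ici 1) s =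
    (logGraph.withDensity fun p => ENNReal.ofReal (Real.exp ((s - 1) * p.2))).map
      (AddMonoidHom.fst ℝ ℝ) := by
  have hm : Measurable (AddMonoidHom.fst ℝ ℝ) := measurable_fst
  refine Measure.ext_of_lintegral _ fun f hf => ?_
  have hfm : Measurable fun a : ℝ × ℝ => f (AddMonoidHom.fst ℝ ℝ a) := hf.comp hm
  rw [lintegral_map hf hm, powMeasure, logGraph,
    lintegral_withDensity_eq_lintegral_mul _ (by fun_prop) hf,
    lintegral_withDensity_eq_lintegral_mul _ (by fun_prop) hfm,
    lintegral_map (Measurable.mul (by fun_prop) hfm) (by fun_prop)]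
  refine setLIntegral_congr_fun measurableSet_Ici fun z hz => ?_
  have hz0 : (0 : ℝ) < z := zero_lt_one.trans_le hz
  simp [Real.rpow_def_of_pos hz0, mul_comm]

/-- The measure whose moment generating function gives the `K`-fold convolution powers of
`z ^ (s - 1) dz` on `[1, ∞)`, evaluated at `(-∞, y]`, as functions of `s`. -/
def logMeasure (K : ℕ) (y : ℝ) : Measure (ℝ × ℝ) :=
  (convPow logGraph K).restrict {p : ℝ × ℝ | p.1 ≤ y}

theorem convPow_powMeasure_Ici_Iic (s : ℝ) (K : ℕ) (y : ℝ) :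
    convPow (powMeasure (Ici 1) s) K (Iic y) =
      ∫⁻ p, ENNReal.ofReal (Real.exp ((s - 1) * p.2)) ∂(logMeasure K y) := by
  have hm : Measurable (AddMonoidHom.fst ℝ ℝ) := measurable_fst
  have hexp (p q : ℝ × ℝ) : ENNReal.ofReal (Real.exp ((s - 1) * (p + q).2)) =
      ENNReal.ofReal (Real.exp ((s - 1) * p.2)) * ENNReal.ofReal (Real.exp ((s - 1) * q.2)) := by
    rw [← ENNReal.ofReal_mul (Real.exp_pos _).le, ← Real.exp_add, Prod.snd_add, mul_add]
  rw [powMeasure_Ici_eq_map_logGraph, convPow_map _ _ hm,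
    convPow_withDensity _ (by fun_prop) (by simp) hexp,
    Measure.map_apply hm measurableSet_Iic, withDensity_apply _ (hm measurableSet_Iic)]
  rfl

theorem integrable_exp_logMeasure (K : ℕ) (y t : ℝ) :
    Integrable (fun p : ℝ × ℝ => Real.exp (t * p.2)) (logMeasure K y) := by
  have h := convPow_powMeasure_Ici_Iic (t + 1) K y
  rw [add_sub_cancel_right] at h
  refine ⟨by fun_prop, ?_⟩
  rw [hasFiniteIntegral_iff_ofReal (.of_forall fun p => (Real.exp_pos _).le), ← h]
  exact IsLocFiniteNonneg.measure_Iic_lt_top y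

theorem mgf_logMeasure (K : ℕ) (y t : ℝ) : mgf Prod.snd (logMeasure K y) t =
    (convPow (powMeasure (Ici 1) (t + 1)) K).real (Iic y) := by
  rw [measureReal_def, convPow_powMeasure_Ici_Iic, add_sub_cancel_right, mgf,
    integral_eq_lintegral_of_nonneg_ae (.of_forall fun p => (Real.exp_pos _).le) (by fun_prop)]

theorem differentiable_complexMGF_logMeasure (K : ℕ) (y : ℝ) :
    Differentiable ℂ (complexMGF Prod.snd (logMeasure K y)) := by
  have huniv : integrableExpSet Prod.snd (logMeasure K y) = univ :=
    eq_univ_of_forall (integrable_exp_logMeasure K y)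
  exact fun z => (analyticAt_complexMGF (by simp [huniv])).differentiableAt

theorem ofReal_pow_mul_measureReal_convPow_powMeasure_Ici (K : ℕ) (y δ : ℝ) :
    ((δ ^ K * (convPow (powMeasure (Ici 1) (-δ)) K).real (Iic y) : ℝ) : ℂ) =
      (δ : ℂ) ^ K * complexMGF Prod.snd (logMeasure K y) (-δ - 1) := by
  have hcast : -(δ : ℂ) - 1 = ((-δ - 1 : ℝ) : ℂ) := by push_cast; rfl
  rw [hcast, complexMGF_ofReal, mgf_logMeasure, sub_add_cancel, Complex.ofReal_mul,
    Complex.ofReal_pow]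

/-- Both sides are analytic in `δ` on the half-plane `re δ < 1`, and they agree for `δ < 0`. -/
theorem pow_mul_measureReal_convPow_powMeasure_Ici {δ : ℝ} (hδ : δ < 1) {K : ℕ} {y : ℝ}
    (hy : (K : ℝ) < y) :
    δ ^ K * (convPow (powMeasure (Ici 1) (-δ)) K).real (Iic y) = paretoFormula K y δ := by
  have hy0 : 0 ≤ y := K.cast_nonneg.trans hy.le
  let U : Set ℂ := {z | z.re < 1}
  have hUo : IsOpen U := isOpen_lt Complex.continuous_re continuous_const
  have hUc : IsPreconnected U := (convex_halfSpace_re_lt 1).isPreconnected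
  let f : ℂ → ℂ := fun z => z ^ K * complexMGF Prod.snd (logMeasure K y) (-z - 1)
  have hf : AnalyticOnNhd ℂ f U := by
    have hmgf := differentiable_complexMGF_logMeasure K y
    have hdiff : Differentiable ℂ f := by fun_prop
    exact hdiff.differentiableOn.analyticOnNhd hUo
  have hg : AnalyticOnNhd ℂ (complexParetoFormula K y) U := DifferentiableOn.analyticOnNhd
    (fun z hz => (differentiableAt_complexParetoFormula hy hz).differentiableWithinAt) hUo
  have hreal : ∀ᶠ x : ℝ in 𝓝[≠] (-1), f x = complexParetoFormula K y x := by
    filter_upwards [nhdsWithin_le_nhds (gt_mem_nhds neg_one_lt_zero)] with x hx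
    rw [← ofReal_paretoFormula K hy0, ← pow_mul_measureReal_convPow_powMeasure_Ici_of_neg hx hy,
      ofReal_pow_mul_measureReal_convPow_powMeasure_Ici]
  have hfreq : ∃ᶠ z in 𝓝[≠] ((-1 : ℝ) : ℂ), f z = complexParetoFormula K y z :=
    (Complex.ofRealCLM.hasDerivAt.tendsto_nhdsNE one_ne_zero).frequently hreal.frequently
  have hEqOn := hf.eqOn_of_preconnected_of_frequently_eq hg hUc
    (show ((-1 : ℝ) : ℂ) ∈ U by simp [U]) hfreq
  apply Complex.ofReal_injective
  rw [ofReal_pow_mul_measureReal_convPow_powMeasure_Ici, ofReal_paretoFormula K hy0]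
  exact hEqOn (show (δ : ℂ) ∈ U by simpa [U] using hδ)

end AnalyticContinuation

section Recursion

theorem coeff_X_mul_derivative {R : Type*} [CommRing R] (g : PowerSeries R) (n : ℕ) :
    PowerSeries.coeff n (PowerSeries.X * PowerSeries.derivative R g) =
      n * PowerSeries.coeff n g := by
  rcases n with _ | n
  · simp
  · rw [PowerSeries.coeff_succ_X_mul, PowerSeries.coeff_derivative, Nat.cast_succ, mul_comm]

/-- Compare coefficients in `i * f' * f ^ i = f * (f ^ i)'`. -/
theorem sum_antidiagonal_mul_coeff_pow_eq_zero {R : Type*} [CommRing R] (f : PowerSeries R)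
    (i j : ℕ) : ∑ p ∈ antidiagonal j,
      ((i : R) * p.1 - p.2) * PowerSeries.coeff p.1 f * PowerSeries.coeff p.2 (f ^ i) = 0 := by
  have hmul : (i : PowerSeries R) * (PowerSeries.X * PowerSeries.derivative R f * f ^ i) -
      f * (PowerSeries.X * PowerSeries.derivative R (f ^ i)) = 0 := by
    rw [PowerSeries.derivative_pow]
    rcases i with _ | i
    · simp
    · rw [Nat.add_sub_cancel, pow_succ]
      ring
  have hcoeff := congrArg (PowerSeries.coeff j) hmul
  rw [map_sub, map_zero, ← nsmul_eq_mul, map_nsmul, PowerSeries.coeff_mul, PowerSeries.coeff_mul,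
    Finset.smul_sum, ← Finset.sum_sub_distrib] at hcoeff
  rw [← hcoeff]
  refine Finset.sum_congr rfl fun p _ => ?_
  rw [coeff_X_mul_derivative, coeff_X_mul_derivative, nsmul_eq_mul]
  ring

theorem natCast_mul_coeff_pow {R : Type*} [CommRing R] {f : PowerSeries R}
    (hf : PowerSeries.coeff 0 f = 1) (i j : ℕ) :
    (j : R) * PowerSeries.coeff j (f ^ i) = ∑ l ∈ Finset.Icc 1 j,
      ((l : R) * (i + 1) - j) * PowerSeries.coeff l f * PowerSeries.coeff (j - l) (f ^ i) := by
  have hsum := sum_antidiagonal_mul_coeff_pow_eq_zero f i j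
  rw [Finset.Nat.sum_antidiagonal_eq_sum_range_succ fun a b =>
      ((i : R) * a - b) * PowerSeries.coeff a f * PowerSeries.coeff b (f ^ i),
    Finset.range_eq_Ico, Finset.sum_eq_sum_Ico_succ_bot (Nat.succ_pos j), hf, Nat.sub_zero,
    Nat.cast_zero, mul_zero, zero_sub, mul_one, neg_mul, neg_add_eq_zero] at hsum
  rw [hsum, zero_add, Nat.succ_eq_add_one, Finset.Ico_add_one_right_eq_Icc]
  refine Finset.sum_congr rfl fun l hl => ?_
  rw [Nat.cast_sub (Finset.mem_Icc.1 hl).2]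
  ring

theorem coeffA_eq_coeff {α : ℝ} (hα : α ≠ 0) (i j : ℕ) :
    coeffA α i j = PowerSeries.coeff j (paretoSeries (2 / α) ^ i) := by
  have hcoeff {l : ℕ} (hl : l ≠ 0) :
      PowerSeries.coeff l (paretoSeries (2 / α)) = 2 / (l ! * (2 - l * α)) := by
    rw [paretoSeries, PowerSeries.coeff_mk, if_neg hl, div_sub' hα, div_mul_eq_mul_div,
      div_div_div_cancel_right₀ hα]
    ring
  induction j using Nat.strong_induction_on with
  | _ j ih =>
    rcases eq_or_ne j 0 with rfl | hj
    · rw [coeffA_zero, PowerSeries.coeff_zero_eq_constantCoeff_apply, map_pow,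
        ← PowerSeries.coeff_zero_eq_constantCoeff_apply, coeff_zero_paretoSeries, one_pow]
    · rw [coeffA_eq α i j (Nat.pos_of_ne_zero hj), one_div,
        inv_mul_eq_iff_eq_mul₀ (Nat.cast_ne_zero.2 hj),
        natCast_mul_coeff_pow (coeff_zero_paretoSeries _)]
      refine Finset.sum_congr rfl fun l hl => ?_
      have hl1 : 1 ≤ l := (Finset.mem_Icc.1 hl).1
      rw [ih (j - l) (by omega), hcoeff (by omega)]

end Recursion

section ParetoCDF

theorem inv_Gamma_one_sub {s : ℝ} (hs : 0 < s) :
    (Real.Gamma (1 - s))⁻¹ = Real.Gamma s * Real.sin (π * s) / π := by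
  have hΓ := (Real.Gamma_pos_of_pos hs).ne'
  have hrefl := congrArg (·⁻¹) (Real.Gamma_mul_Gamma_one_sub s)
  simp only [mul_inv, inv_div] at hrefl
  rw [mul_div_assoc, ← hrefl, mul_inv_cancel_left₀ hΓ]

/-- The `m`-th term of the series in `paretoCDF_eq`. -/
def paretoTerm (α : ℝ) (K l : ℕ) (y : ℝ) (m : ℕ) : ℝ :=
  coeffA α (K - l) m * Real.Gamma (m + 2 / α * l) * y ^ (-(m : ℝ) - 2 / α * l)

theorem paretoTerm_eq {α : ℝ} (hα : 0 < α) (K : ℕ) {l : ℕ} (hl : l ≠ 0) {y : ℝ} (hy : 0 < y)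
    (m : ℕ) : paretoTerm α K l y m =
      Real.Gamma (2 / α * l) * y ^ (-(2 / α * l)) * tailTerm y (2 / α) (K - l) l m := by
  have hs : 0 < 2 / α * (l : ℝ) := by positivity
  rw [paretoTerm, tailTerm, coeffA_eq_coeff hα.ne', Gamma_natCast_add hs, sub_eq_add_neg,
    Real.rpow_add hy, Real.rpow_neg hy.le (m : ℝ), Real.rpow_natCast, inv_pow]
  ring

theorem summable_norm_paretoTerm {α : ℝ} (hα : 2 < α) {K l : ℕ} (hl : l ≠ 0) (hlK : l ≤ K) {y : ℝ}
    (hy : (K : ℝ) ≤ y) : Summable fun m => ‖paretoTerm α K l y m‖ := by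
  have hα0 : 0 < α := two_pos.trans hα
  have hKl : ((K - l : ℕ) : ℝ) < y := lt_of_lt_of_le (Nat.cast_lt.2 (by omega)) hy
  have hy0 : 0 < y := (Nat.cast_nonneg _).trans_lt hKl
  simp only [paretoTerm_eq hα0 K hl hy0, norm_mul _ (tailTerm _ _ _ _ _)]
  refine (summable_norm_tailTerm ?_ ?_ l).mul_left _
  · exact (div_lt_one hα0).2 hα
  · rwa [Real.norm_of_nonneg hy0.le]

/-- The distribution function of the sum of `K` independent Pareto variables with tail
`y ^ (-2 / α)` on `[1, ∞)`. -/
def paretoCDF (α : ℝ) (K : ℕ) (y : ℝ) : ℝ :=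
  (2 / α) ^ K * (convPow (powMeasure (Ici 1) (-(2 / α))) K).real (Iic y)

theorem paretoCDF_eq {α : ℝ} (hα : 2 < α) {K : ℕ} {y : ℝ} (hy : (K : ℝ) < y) :
    paretoCDF α K y = 1 + 1 / π * ∑ l ∈ Finset.Icc 1 K,
      (K.choose l : ℝ) * (-Real.Gamma (1 - 2 / α)) ^ l * Real.sin (2 * π * l / α) *
        ∑' m : ℕ, paretoTerm α K l y m := by
  have hα0 : 0 < α := two_pos.trans hα
  have hy0 : 0 < y := K.cast_nonneg.trans_lt hy
  rw [paretoCDF, pow_mul_measureReal_convPow_powMeasure_Ici ((div_lt_one hα0).2 hα) hy,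
    paretoFormula, Finset.Nat.sum_antidiagonal_eq_sum_range_succ fun p j =>
      (K.choose p : ℝ) * (-Real.Gamma (1 - 2 / α)) ^ p * y ^ (-(2 / α * p)) *
        (Real.Gamma (1 - 2 / α * p))⁻¹ * tailSum y (2 / α) j p,
    Finset.range_eq_Ico, Finset.sum_eq_sum_Ico_succ_bot K.succ_pos, zero_add,
    Nat.succ_eq_add_one, Finset.Ico_add_one_right_eq_Icc, Finset.mul_sum]
  congr 1
  · simp [tailSum_zero]
  refine Finset.sum_congr rfl fun l hl => ?_
  have hl0 : l ≠ 0 := Nat.one_le_iff_ne_zero.1 (Finset.mem_Icc.1 hl).1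
  have hsin : π * (2 / α * l) = 2 * π * l / α := by ring
  rw [inv_Gamma_one_sub (by positivity), hsin, tsum_congr (paretoTerm_eq hα0 K hl0 hy0),
    tsum_mul_left, tailSum]
  ring

theorem paretoCDF_of_lt (α : ℝ) {K : ℕ} {y : ℝ} (hy : y < K) : paretoCDF α K y = 0 := by
  have hae := ae_convPow_natCast_mul_le
    (ae_mem_powMeasure (measurableSet_Ici (a := (1 : ℝ))) (-(2 / α))) K
  have hnull : convPow (powMeasure (Ici 1) (-(2 / α))) K (Iic y) = 0 := by
    refine measure_mono_null (fun w hw => ?_) (ae_iff.1 hae)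
    simpa using (mem_Iic.1 hw).trans_lt hy
  rw [paretoCDF, measureReal_def, hnull, ENNReal.toReal_zero, mul_zero]

end ParetoCDF

section UniformCube

theorem powMeasure_Ici_Iic {s z : ℝ} (hs : 0 < s) (hz : 1 ≤ z) :
    powMeasure (Ici 1) (-s) (Iic z) = ENNReal.ofReal ((1 - z ^ (-s)) / s) := by
  have hpos {u : ℝ} (hu : u ∈ Icc 1 z) : 0 < u := one_pos.trans_le hu.1
  have hint : IntegrableOn (fun u : ℝ => u ^ (-s - 1)) (Icc 1 z) :=
    ContinuousOn.integrableOn_Icc fun u hu =>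
      (Real.continuousAt_rpow_const _ _ (.inl (hpos hu).ne')).continuousWithinAt
  have hnonneg : 0 ≤ᵐ[volume.restrict (Icc 1 z)] fun u : ℝ => u ^ (-s - 1) :=
    (ae_restrict_mem measurableSet_Icc).mono fun u hu => Real.rpow_nonneg (hpos hu).le _
  have h0 : (0 : ℝ) ∉ uIcc 1 z := fun h => (hpos (uIcc_of_le hz ▸ h)).ne rfl
  rw [powMeasure, withDensity_apply _ measurableSet_Iic,
    Measure.restrict_restrict measurableSet_Iic, Iic_inter_Ici,
    ← ofReal_integral_eq_lintegral_ofReal hint hnonneg,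
    integral_Icc_eq_integral_Ioc, ← intervalIntegral.integral_of_le hz,
    integral_rpow (.inr ⟨by linarith, h0⟩), sub_add_cancel, Real.one_rpow, div_neg, ← neg_div,
    neg_sub]

theorem powMeasure_Ici_Iic_of_lt {s z : ℝ} (hz : z < 1) :
    powMeasure (Ici 1) s (Iic z) = 0 := by
  rw [powMeasure, withDensity_apply _ measurableSet_Iic,
    Measure.restrict_restrict measurableSet_Iic, Iic_inter_Ici,
    Icc_eq_empty hz.not_ge, Measure.restrict_empty, lintegral_zero_measure]

theorem map_rpow_volume_Ioo {s t : ℝ} (hs : 0 < s) (ht : 0 < t) :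
    (volume.restrict (Ioo 0 t)).map (fun u : ℝ => (u / t) ^ (-s⁻¹)) =
      ENNReal.ofReal (t * s) • powMeasure (Ici 1) (-s) := by
  have hf : Measurable fun u : ℝ => (u / t) ^ (-s⁻¹) := by fun_prop
  have hs' : -s⁻¹ < 0 := neg_lt_zero.2 (inv_pos.2 hs)
  refine Measure.ext_of_Iic _ _ fun z => ?_
  rw [Measure.map_apply hf measurableSet_Iic, Measure.restrict_apply (hf measurableSet_Iic),
    Measure.smul_apply, smul_eq_mul]
  rcases lt_or_ge z 1 with hz | hz
  · have hpre : (fun u : ℝ => (u / t) ^ (-s⁻¹)) ⁻¹' Iic z ∩ Ioo 0 t = ∅ := by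
      refine disjoint_iff_inter_eq_empty.1 (disjoint_left.2 fun u hu hut => hz.not_ge ?_)
      exact (Real.one_le_rpow_of_pos_of_le_one_of_nonpos (div_pos hut.1 ht)
        ((div_le_one ht).2 hut.2.le) hs'.le).trans hu
    rw [hpre, measure_empty, powMeasure_Ici_Iic_of_lt hz, mul_zero]
  · have hz0 : 0 < z := one_pos.trans_le hz
    have hzs : 0 < z ^ (-s) := Real.rpow_pos_of_pos hz0 _
    have hinv : (z ^ (-s)) ^ (-s⁻¹) = z := by
      rw [← Real.rpow_mul hz0.le, neg_mul_neg, mul_inv_cancel₀ hs.ne', Real.rpow_one]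
    have hle {u : ℝ} (hu : 0 < u) : (u / t) ^ (-s⁻¹) ≤ z ↔ t * z ^ (-s) ≤ u := by
      conv_lhs => rw [← hinv]
      rw [Real.rpow_le_rpow_iff_of_neg (div_pos hu ht) hzs hs', le_div_iff₀' ht]
    have hpre : (fun u : ℝ => (u / t) ^ (-s⁻¹)) ⁻¹' Iic z ∩ Ioo 0 t = Ico (t * z ^ (-s)) t := by
      ext u
      refine ⟨fun hu => ⟨(hle hu.2.1).1 hu.1, hu.2.2⟩, fun hu => ?_⟩
      have hu0 : 0 < u := (mul_pos ht hzs).trans_le hu.1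
      exact ⟨(hle hu0).2 hu.1, hu0, hu.2⟩
    rw [hpre, Real.volume_Ico, powMeasure_Ici_Iic hs hz, ← ENNReal.ofReal_mul (mul_pos ht hs).le]
    congr 1
    field_simp

theorem volume_cube_sum_rpow_le {α t : ℝ} (hα : 0 < α) (ht : 0 < t) (K : ℕ) (x : ℝ) :
    volume {u : Fin K → ℝ | (∀ i, u i ∈ Ioo 0 t) ∧ ∑ i, u i ^ (-(α / 2)) ≤ x} =
      ENNReal.ofReal (t ^ K * paretoCDF α K (x * t ^ (α / 2))) := by
  have hf : Measurable fun u : ℝ => (u / t) ^ (-(α / 2)) := by fun_prop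
  have hsum : Measurable fun u : Fin K → ℝ => ∑ i, (u i / t) ^ (-(α / 2)) := by fun_prop
  have hmap := map_rpow_volume_Ioo (s := 2 / α) (by positivity) ht
  rw [inv_div] at hmap
  have hset : {u : Fin K → ℝ | (∀ i, u i ∈ Ioo 0 t) ∧ ∑ i, u i ^ (-(α / 2)) ≤ x} =
      (fun u : Fin K → ℝ => ∑ i, (u i / t) ^ (-(α / 2))) ⁻¹' Iic (x * t ^ (α / 2)) ∩
        univ.pi fun _ => Ioo 0 t := by
    ext u
    rw [mem_inter_iff, mem_univ_pi, mem_ofPred_eq, and_comm]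
    refine and_congr_left fun hu => ?_
    have hscale : ∑ i, (u i / t) ^ (-(α / 2)) = (∑ i, u i ^ (-(α / 2))) * t ^ (α / 2) := by
      rw [Finset.sum_mul]
      refine Finset.sum_congr rfl fun i _ => ?_
      rw [Real.div_rpow (hu i).1.le ht.le, Real.rpow_neg ht.le, div_inv_eq_mul]
    rw [mem_preimage, hscale, mem_Iic, mul_le_mul_iff_left₀ (Real.rpow_pos_of_pos ht _)]
  rw [hset, ← Measure.restrict_apply (hsum measurableSet_Iic), volume_pi, Measure.restrict_pi_pi,
    ← Measure.map_apply hsum measurableSet_Iic, map_sum_pi _ hf, hmap, convPow_smul,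
    Measure.smul_apply, smul_eq_mul, paretoCDF, ← mul_assoc, ← mul_pow,
    ENNReal.ofReal_mul (p := (t * (2 / α)) ^ K) (by positivity), ENNReal.ofReal_pow (by positivity),
    ofReal_measureReal (IsLocFiniteNonneg.measure_Iic_ne_top _)]

end UniformCube

section NearestDist

variable {S : Set Plane}

theorem nearestDist_nonneg (S : Set Plane) (i : ℕ) : 0 ≤ nearestDist S i :=
  Real.sInf_nonneg fun _ hr => hr.1

theorem natCast_le_encard_closedBall_iff
    (hS : ∀ B : Set Plane, Bornology.IsBounded B → (S ∩ B).Finite) (i : ℕ) (r : ℝ) :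
    (i : ℕ∞) ≤ (S ∩ Metric.closedBall 0 r).encard ↔ i ≤ (S ∩ Metric.closedBall 0 r).ncard := by
  rw [← (hS _ Metric.isBounded_closedBall).cast_ncard_eq, Nat.cast_le]

theorem ncard_closedBall_mono
    (hS : ∀ B : Set Plane, Bornology.IsBounded B → (S ∩ B).Finite) {r r' : ℝ} (h : r ≤ r') :
    (S ∩ Metric.closedBall 0 r).ncard ≤ (S ∩ Metric.closedBall 0 r').ncard :=
  ncard_le_ncard (inter_subset_inter_right _ (Metric.closedBall_subset_closedBall h))
    (hS _ Metric.isBounded_closedBall)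

theorem eventually_inter_closedBall_subset
    (hS : ∀ B : Set Plane, Bornology.IsBounded B → (S ∩ B).Finite) (r₀ : ℝ) :
    ∀ᶠ r in 𝓝 r₀, S ∩ Metric.closedBall 0 r ⊆ S ∩ Metric.closedBall 0 r₀ := by
  have hfar : ∀ᶠ r in 𝓝 r₀, ∀ x ∈ S ∩ Metric.closedBall 0 (r₀ + 1), r₀ < ‖x‖ → r < ‖x‖ := by
    rw [eventually_all_finite (hS _ Metric.isBounded_closedBall)]
    exact fun x _ => eventually_imp_distrib_left.2 gt_mem_nhds
  filter_upwards [hfar, gt_mem_nhds (lt_add_one r₀)] with r hr hr1 x ⟨hxS, hxr⟩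
  refine ⟨hxS, ?_⟩
  rw [mem_closedBall_zero_iff] at hxr ⊢
  refine not_lt.1 fun hx => (hr x ⟨hxS, ?_⟩ hx).not_ge hxr
  exact mem_closedBall_zero_iff.2 (hxr.trans hr1.le)

theorem le_ncard_closedBall_nearestDist
    (hS : ∀ B : Set Plane, Bornology.IsBounded B → (S ∩ B).Finite) {i : ℕ} {r : ℝ} (hr : 0 ≤ r)
    (hi : i ≤ (S ∩ Metric.closedBall 0 r).ncard) :
    i ≤ (S ∩ Metric.closedBall 0 (nearestDist S i)).ncard := by
  let T : Set ℝ := {r | 0 ≤ r ∧ (i : ℕ∞) ≤ (S ∩ Metric.closedBall 0 r).encard}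
  have hT : T.Nonempty := ⟨r, hr, (natCast_le_encard_closedBall_iff hS i r).2 hi⟩
  have hglb : IsGLB T (nearestDist S i) := isGLB_csInf hT ⟨0, fun _ h => h.1⟩
  obtain ⟨r', hr', hsub⟩ := ((hglb.frequently_mem hT).and_eventually
    (nhdsWithin_le_nhds (eventually_inter_closedBall_subset hS _))).exists
  exact (natCast_le_encard_closedBall_iff hS i _).1 (hr'.2.trans (encard_le_encard hsub))

theorem nearestDist_le_iff_of_le_ncard
    (hS : ∀ B : Set Plane, Bornology.IsBounded B → (S ∩ B).Finite)
    {i : ℕ} {r r' : ℝ} (hr : 0 ≤ r) (hr' : 0 ≤ r')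
    (hi : i ≤ (S ∩ Metric.closedBall 0 r').ncard) :
    nearestDist S i ≤ r ↔ i ≤ (S ∩ Metric.closedBall 0 r).ncard :=
  ⟨fun h => (le_ncard_closedBall_nearestDist hS hr' hi).trans (ncard_closedBall_mono hS h),
    fun h => csInf_le ⟨0, fun _ h => h.1⟩ ⟨hr, (natCast_le_encard_closedBall_iff hS i r).2 h⟩⟩

theorem nearestDist_eq_zero_of_forall_ncard_lt
    (hS : ∀ B : Set Plane, Bornology.IsBounded B → (S ∩ B).Finite) {i : ℕ}
    (h : ∀ r, 0 ≤ r → (S ∩ Metric.closedBall 0 r).ncard < i) : nearestDist S i = 0 := by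
  have hempty : {r : ℝ | 0 ≤ r ∧ (i : ℕ∞) ≤ (S ∩ Metric.closedBall 0 r).encard} = ∅ :=
    eq_empty_of_forall_notMem fun r hr =>
      (h r hr.1).not_ge ((natCast_le_encard_closedBall_iff hS i r).1 hr.2)
  rw [nearestDist, hempty, Real.sInf_empty]

theorem nearestDist_mem_Ioc_iff
    (hS : ∀ B : Set Plane, Bornology.IsBounded B → (S ∩ B).Finite)
    {i : ℕ} {r r' : ℝ} (hr : 0 ≤ r) (hr' : 0 ≤ r') :
    nearestDist S i ∈ Ioc r r' ↔
      (S ∩ Metric.closedBall 0 r).ncard < i ∧ i ≤ (S ∩ Metric.closedBall 0 r').ncard := by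
  by_cases hex : ∃ R, 0 ≤ R ∧ i ≤ (S ∩ Metric.closedBall 0 R).ncard
  · obtain ⟨R, hR, hi⟩ := hex
    rw [mem_Ioc, ← not_le, nearestDist_le_iff_of_le_ncard hS hr hR hi,
      nearestDist_le_iff_of_le_ncard hS hr' hR hi, not_le]
  · refine iff_of_false (fun h => ?_) fun h => hex ⟨r', hr', h.2⟩
    push Not at hex
    exact hr.not_gt (nearestDist_eq_zero_of_forall_ncard_lt hS hex ▸ h.1)

/-- The second alternative accounts for point sets with fewer than `i` points, for which
`nearestDist` is the infimum of the empty set. -/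
theorem nearestDist_le_iff
    (hS : ∀ B : Set Plane, Bornology.IsBounded B → (S ∩ B).Finite)
    {i : ℕ} {r : ℝ} (hr : 0 ≤ r) : nearestDist S i ≤ r ↔
      i ≤ (S ∩ Metric.closedBall 0 r).ncard ∨
        ∀ k : ℕ, (S ∩ Metric.closedBall 0 (k : ℝ)).ncard < i := by
  by_cases hex : ∃ k : ℕ, i ≤ (S ∩ Metric.closedBall 0 (k : ℝ)).ncard
  · obtain ⟨k, hk⟩ := hex
    rw [nearestDist_le_iff_of_le_ncard hS hr k.cast_nonneg hk]
    exact (or_iff_left fun h => (h k).not_ge hk).symm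
  · push Not at hex
    have hzero : nearestDist S i = 0 := nearestDist_eq_zero_of_forall_ncard_lt hS fun R _ => by
      obtain ⟨k, hk⟩ := exists_nat_ge R
      exact (ncard_closedBall_mono hS hk).trans_lt (hex k)
    exact iff_of_true (hzero.trans_le hr) (.inr hex)

end NearestDist

section Measurability

variable {Ω : Type*} [MeasurableSpace Ω] {P : Measure Ω} {lam : ℝ} {Φ : Ω → Set Plane}

theorem measurable_nearestDist (hΦ : IsHPPP P lam Φ) (i : ℕ) :
    Measurable fun ω => nearestDist (Φ ω) i := by
  have hcount (r : ℝ) : Measurable fun ω => (Φ ω ∩ Metric.closedBall 0 r).ncard :=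
    hΦ.measurable_count _ Metric.isClosed_closedBall.measurableSet Metric.isBounded_closedBall
  refine measurable_of_Iic fun r => ?_
  rcases lt_or_ge r 0 with hr | hr
  · convert MeasurableSet.empty
    exact eq_empty_of_forall_notMem fun ω h => hr.not_ge ((nearestDist_nonneg _ _).trans h)
  · have hset : (fun ω => nearestDist (Φ ω) i) ⁻¹' Iic r =
        {ω | i ≤ (Φ ω ∩ Metric.closedBall 0 r).ncard} ∪
          ⋂ k : ℕ, {ω | (Φ ω ∩ Metric.closedBall 0 (k : ℝ)).ncard < i} := by
      ext ω
      rw [mem_preimage, mem_Iic, nearestDist_le_iff (hΦ.finite_inter ω) hr, mem_union, mem_iInter]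
      rfl
    rw [hset]
    exact (measurableSet_le measurable_const (hcount r)).union
      (.iInter fun k => measurableSet_lt (hcount k) measurable_const)

theorem measurable_pathLossSum (hΦ : IsHPPP P lam Φ) (α : ℝ) (K : ℕ) :
    Measurable fun ω => pathLossSum α K (Φ ω) :=
  Finset.measurable_sum _ fun i _ => (measurable_nearestDist hΦ i).pow_const _

end Measurability

section Interlacing

theorem interlace_iff {n : ℕ} {a b e : Fin (n + 1) → ℕ} {z : ℕ} (hab : ∀ i, a i + e i = b i)
    (hba : ∀ i : Fin n, b i.castSucc ≤ a i.succ)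
    (hz : z + ∑ i : Fin n, e i.castSucc = a (Fin.last n)) :
    (∀ i : Fin (n + 1), a i < (i : ℕ) + 1 ∧ (i : ℕ) + 1 ≤ b i) ↔
      z = 0 ∧ (∀ i : Fin n, e i.castSucc = 1) ∧ 1 ≤ e (Fin.last n) := by
  constructor
  · intro h
    have ha (i : Fin (n + 1)) : a i = i := by
      refine le_antisymm (Nat.lt_succ_iff.1 (h i).1) ?_
      cases i using Fin.cases with
      | zero => exact Nat.zero_le _
      | succ i => simpa using (h i.castSucc).2.trans (hba i)
    have he (i : Fin n) : e i.castSucc = 1 := by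
      have hle := hba i
      have hge := (h i.castSucc).2
      rw [← hab, ha, Fin.val_castSucc] at hle hge
      rw [ha, Fin.val_succ] at hle
      omega
    have hlast := (h (Fin.last n)).2
    rw [← hab, ha] at hlast
    simp only [he, ha, Finset.sum_const, Finset.card_univ, Fintype.card_fin, smul_eq_mul, mul_one,
      Fin.val_last] at hz
    exact ⟨by omega, he, by omega⟩
  · rintro ⟨rfl, he, hlast⟩
    simp only [he, Finset.sum_const, Finset.card_univ, Fintype.card_fin, smul_eq_mul, mul_one,
      zero_add] at hz
    have hstep (i : Fin n) : a i.castSucc + 1 ≤ a i.succ := by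
      rw [← he i, hab]
      exact hba i
    have hlower (i : Fin (n + 1)) : (i : ℕ) ≤ a i := by
      induction i using Fin.induction with
      | zero => exact Nat.zero_le _
      | succ i ih => exact (Nat.succ_le_succ ih).trans (hstep i)
    have hupper (i : Fin (n + 1)) : a i ≤ i := by
      induction i using Fin.reverseInduction with
      | last => exact hz.ge
      | cast i ih => exact Nat.succ_le_succ_iff.1 ((hstep i).trans ih)
    have hpos (i : Fin (n + 1)) : 1 ≤ e i := by
      cases i using Fin.lastCases with
      | last => exact hlast
      | cast i => exact (he i).ge
    exact fun i => ⟨Nat.lt_succ_of_le (hupper i), hab i ▸ Nat.add_le_add (hlower i) (hpos i)⟩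

variable {X : Type*} {n : ℕ} {A B : Fin (n + 1) → Set X}

theorem pairwise_disjoint_sdiff (hAB : ∀ i, A i ⊆ B i)
    (hBA : ∀ i : Fin n, B i.castSucc ⊆ A i.succ) :
    Pairwise (Function.onFun Disjoint fun i => B i \ A i) := by
  have hA : Monotone A := Fin.monotone_iff_le_succ.2 fun i => (hAB _).trans (hBA i)
  refine (pairwise_disjoint_on _).2 fun i j hij => disjoint_left.2 fun x hxi hxj => hxj.2 ?_
  cases i using Fin.lastCases with
  | last => exact absurd hij (Fin.le_last j).not_gt
  | cast i => exact hA (Fin.castSucc_lt_iff_succ_le.1 hij) (hBA i hxi.1)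

theorem iUnion_sdiff_castSucc_subset (hAB : ∀ i, A i ⊆ B i)
    (hBA : ∀ i : Fin n, B i.castSucc ⊆ A i.succ) :
    ⋃ i : Fin n, B i.castSucc \ A i.castSucc ⊆ A (Fin.last n) := by
  have hA : Monotone A := Fin.monotone_iff_le_succ.2 fun i => (hAB _).trans (hBA i)
  exact iUnion_subset fun i => sdiff_subset.trans ((hBA i).trans (hA (Fin.le_last _)))

/-- The left-hand side says that the `(i + 1)`-st point of `S` met by the growing sets
`A 0 ⊆ B 0 ⊆ A 1 ⊆ B 1 ⊆ ⋯` lies in `B i \ A i`. -/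
theorem ncard_interlace_iff (hAB : ∀ i, A i ⊆ B i) (hBA : ∀ i : Fin n, B i.castSucc ⊆ A i.succ)
    {S : Set X} (hfin : ∀ i, (S ∩ B i).Finite) :
    (∀ i : Fin (n + 1), (S ∩ A i).ncard < (i : ℕ) + 1 ∧ (i : ℕ) + 1 ≤ (S ∩ B i).ncard) ↔
      (S ∩ (A (Fin.last n) \ ⋃ i : Fin n, B i.castSucc \ A i.castSucc)).ncard = 0 ∧
        (∀ i : Fin n, (S ∩ (B i.castSucc \ A i.castSucc)).ncard = 1) ∧
        1 ≤ (S ∩ (B (Fin.last n) \ A (Fin.last n))).ncard := by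
  have hfinA (i) : (S ∩ A i).Finite := (hfin i).subset (inter_subset_inter_right _ (hAB i))
  have hsdiff {U V : Set X} (hUV : U ⊆ V) (hV : (S ∩ V).Finite) :
      (S ∩ U).ncard + (S ∩ (V \ U)).ncard = (S ∩ V).ncard := by
    rw [← inter_sdiff_assoc, ← ncard_inter_add_ncard_sdiff_eq_ncard (S ∩ V) U hV, inter_assoc,
      inter_eq_right.2 hUV]
  refine interlace_iff (e := fun i => (S ∩ (B i \ A i)).ncard) (fun i => hsdiff (hAB i) (hfin i))
    (fun i => ncard_le_ncard (inter_subset_inter_right _ (hBA i)) (hfinA _)) ?_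
  have hdisj : Pairwise (Function.onFun Disjoint
      fun i : Fin n => S ∩ (B i.castSucc \ A i.castSucc)) := fun i j hij =>
    (pairwise_disjoint_sdiff hAB hBA ((Fin.castSucc_injective n).ne hij)).mono
      inter_subset_right inter_subset_right
  have hfinE (i : Fin n) : (S ∩ (B i.castSucc \ A i.castSucc)).Finite :=
    (hfin _).subset (inter_subset_inter_right _ sdiff_subset)
  rw [← finsum_eq_sum_of_fintype, ← ncard_iUnion_of_finite hfinE hdisj, ← inter_iUnion, add_comm]
  exact hsdiff (iUnion_sdiff_castSucc_subset hAB hBA) (hfinA _)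

end Interlacing

section Disk

variable {lam : ℝ}

/-- The disk around the origin that contains `u` points on average. -/
def disk (lam u : ℝ) : Set Plane :=
  Metric.closedBall 0 √(u / (lam * π))

theorem disk_mono (hlam : 0 ≤ lam) : Monotone (disk lam) := fun _ _ h =>
  Metric.closedBall_subset_closedBall
    (Real.sqrt_le_sqrt (div_le_div_of_nonneg_right h (mul_nonneg hlam Real.pi_pos.le)))

theorem measurableSet_disk (lam u : ℝ) : MeasurableSet (disk lam u) :=
  Metric.isClosed_closedBall.measurableSet

theorem isBounded_disk (lam u : ℝ) : Bornology.IsBounded (disk lam u) :=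
  Metric.isBounded_closedBall

theorem mul_measureReal_disk {u : ℝ} (hlam : 0 < lam) (hu : 0 ≤ u) :
    lam * volume.real (disk lam u) = u := by
  have hpi := Real.pi_pos
  rw [disk, measureReal_def, EuclideanSpace.volume_closedBall_fin_two, ENNReal.toReal_mul,
    ENNReal.toReal_pow, ENNReal.toReal_ofReal (Real.sqrt_nonneg _), Real.sq_sqrt (by positivity),
    ENNReal.toReal_ofReal hpi.le]
  field_simp

theorem mul_measureReal_disk_sdiff {u v : ℝ} (hlam : 0 < lam) (hu : 0 ≤ u) (huv : u ≤ v) :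
    lam * volume.real (disk lam v \ disk lam u) = v - u := by
  rw [measureReal_sdiff (disk_mono hlam.le huv) (measurableSet_disk lam u)
    (isBounded_disk lam v).measure_lt_top.ne, mul_sub, mul_measureReal_disk hlam (hu.trans huv),
    mul_measureReal_disk hlam hu]

/-- The mean number of points in the disk through the `i`-th nearest point of `S`. In this scale the
distances form a Poisson process of unit density on the half-line. -/
def scaledDist (lam : ℝ) (S : Set Plane) (i : ℕ) : ℝ :=
  lam * π * nearestDist S i ^ 2

theorem scaledDist_mem_Ioc_iff (hlam : 0 < lam) {S : Set Plane}
    (hS : ∀ B : Set Plane, Bornology.IsBounded B → (S ∩ B).Finite) {i : ℕ} {a b : ℝ}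
    (ha : 0 ≤ a) (hb : 0 ≤ b) : scaledDist lam S i ∈ Ioc a b ↔
      (S ∩ disk lam a).ncard < i ∧ i ≤ (S ∩ disk lam b).ncard := by
  have hc : 0 < lam * π := mul_pos hlam Real.pi_pos
  rw [disk, disk, ← nearestDist_mem_Ioc_iff hS (Real.sqrt_nonneg _) (Real.sqrt_nonneg _), mem_Ioc,
    mem_Ioc, scaledDist, Real.sqrt_lt (div_nonneg ha hc.le) (nearestDist_nonneg _ _),
    Real.le_sqrt (nearestDist_nonneg _ _) (div_nonneg hb hc.le), div_lt_iff₀' hc,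
    le_div_iff₀' hc]

end Disk

section Counts

theorem poissonMeasure_Ici_one (r : NNReal) :
    poissonMeasure r (Ici 1) = ENNReal.ofReal (1 - Real.exp (-r)) := by
  have hcompl : (Ici 1 : Set ℕ) = {0}ᶜ := by
    ext k
    exact Nat.one_le_iff_ne_zero
  rw [hcompl, prob_compl_eq_one_sub (measurableSet_singleton 0), poissonMeasure_singleton, pow_zero,
    Nat.factorial_zero, Nat.cast_one, mul_one, div_one, ← ENNReal.ofReal_one,
    ← ENNReal.ofReal_sub _ (Real.exp_pos _).le]

theorem pairwise_disjoint_sdiff_iUnion {ι X : Type*} {D F : Set X} {E : ι → Set X}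
    (hED : ⋃ i, E i ⊆ D) (hEE : Pairwise (Function.onFun Disjoint E)) (hDF : Disjoint D F) :
    Pairwise (Function.onFun Disjoint fun o : Option (Option ι) =>
      o.elim (D \ ⋃ i, E i) fun o => o.elim F E) := by
  have hgapF : Disjoint (D \ ⋃ i, E i) F := hDF.mono_left sdiff_subset
  have hgapE (i) : Disjoint (D \ ⋃ i, E i) (E i) :=
    disjoint_sdiff_left.mono_right (subset_iUnion E i)
  have hFE (i) : Disjoint F (E i) := (hDF.mono_left ((subset_iUnion E i).trans hED)).symm
  rintro (_ | _ | i) (_ | _ | j) hij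
  exacts [(hij rfl).elim, hgapF, hgapE j, hgapF.symm, (hij rfl).elim, hFE j, (hgapE i).symm,
    (hFE i).symm, hEE fun h => hij (congrArg (some ∘ some) h)]

variable {Ω : Type*} [MeasurableSpace Ω] {P : Measure Ω} {lam : ℝ} {Φ : Ω → Set Plane}
  {ι : Type*} [Fintype ι]

theorem measure_forall_ncard_mem (hΦ : IsHPPP P lam Φ) {B : ι → Set Plane}
    (hB : ∀ i, MeasurableSet (B i)) (hbdd : ∀ i, Bornology.IsBounded (B i))
    (hdisj : Pairwise (Function.onFun Disjoint B)) (T : ι → Set ℕ) :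
    P {ω | ∀ i, (Φ ω ∩ B i).ncard ∈ T i} =
      ∏ i, poissonMeasure (lam * volume.real (B i)).toNNReal (T i) := by
  let e := Fintype.equivFin ι
  have hindep : iIndepFun (fun i ω => (Φ ω ∩ B i).ncard) P := by
    simpa only [Function.comp_apply, Equiv.symm_apply_apply] using
      (hΦ.indep_count _ (B ∘ e.symm) (fun _ => hB _) (fun _ => hbdd _)
        fun k l hkl => hdisj (e.symm.injective.ne hkl)).precomp e.injective
  have hset : {ω | ∀ i, (Φ ω ∩ B i).ncard ∈ T i} =
      ⋂ i ∈ Finset.univ, (fun ω => (Φ ω ∩ B i).ncard) ⁻¹' T i := by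
    ext ω
    simp only [mem_ofPred_eq, Finset.mem_univ, iInter_true, mem_iInter, mem_preimage]
  rw [hset, hindep.measure_inter_preimage_eq_mul Finset.univ fun _ _ => .of_discrete]
  refine Finset.prod_congr rfl fun i _ => ?_
  rw [← hΦ.map_count _ (hB i) (hbdd i),
    Measure.map_apply (hΦ.measurable_count _ (hB i) (hbdd i)) .of_discrete]

theorem measure_ncard_eq_one (hΦ : IsHPPP P lam Φ) (hlam : 0 ≤ lam) {D F : Set Plane}
    {E : ι → Set Plane} (hD : MeasurableSet D) (hDb : Bornology.IsBounded D)
    (hF : MeasurableSet F) (hFb : Bornology.IsBounded F) (hE : ∀ i, MeasurableSet (E i))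
    (hED : ⋃ i, E i ⊆ D) (hEE : Pairwise (Function.onFun Disjoint E)) (hDF : Disjoint D F) :
    P {ω | (Φ ω ∩ (D \ ⋃ i, E i)).ncard = 0 ∧ (∀ i, (Φ ω ∩ E i).ncard = 1) ∧
        1 ≤ (Φ ω ∩ F).ncard} =
      ENNReal.ofReal ((∏ i, lam * volume.real (E i)) * (Real.exp (-(lam * volume.real D)) *
        (1 - Real.exp (-(lam * volume.real F))))) := by
  have hED' (i) : E i ⊆ D := (subset_iUnion E i).trans hED
  have hEb (i) : Bornology.IsBounded (E i) := hDb.subset (hED' i)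
  have hU : MeasurableSet (⋃ i, E i) := .iUnion hE
  let B : Option (Option ι) → Set Plane := fun o => o.elim (D \ ⋃ i, E i) fun o => o.elim F E
  let T : Option (Option ι) → Set ℕ := fun o => o.elim {0} fun o => o.elim (Ici 1) fun _ => {1}
  have hprob := measure_forall_ncard_mem hΦ (B := B)
    (by rintro (_ | _ | i); exacts [hD.diff hU, hF, hE i])
    (by rintro (_ | _ | i); exacts [hDb.subset sdiff_subset, hFb, hEb i])
    (pairwise_disjoint_sdiff_iUnion hED hEE hDF) T
  have hset : {ω | (Φ ω ∩ (D \ ⋃ i, E i)).ncard = 0 ∧ (∀ i, (Φ ω ∩ E i).ncard = 1) ∧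
      1 ≤ (Φ ω ∩ F).ncard} = {ω | ∀ o, (Φ ω ∩ B o).ncard ∈ T o} := by
    ext ω
    simp only [mem_ofPred_eq, Option.forall, B, T, Option.elim_none, Option.elim_some,
      mem_singleton_iff, mem_Ici]
    exact and_congr_right' and_comm
  have hvol : volume.real D = volume.real (D \ ⋃ i, E i) + ∑ i, volume.real (E i) := by
    rw [← measureReal_iUnion_fintype hEE hE fun i => (hEb i).measure_lt_top.ne,
      measureReal_sdiff hED hU hDb.measure_lt_top.ne, sub_add_cancel]
  have hmean (A : Set Plane) : ((lam * volume.real A).toNNReal : ℝ) = lam * volume.real A :=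
    Real.coe_toNNReal _ (mul_nonneg hlam measureReal_nonneg)
  have hexp (A : Set Plane) : 0 ≤ 1 - Real.exp (-(lam * volume.real A)) :=
    sub_nonneg.2 (Real.exp_le_one_iff.2 (neg_nonpos.2 (mul_nonneg hlam measureReal_nonneg)))
  rw [hset, hprob, Fintype.prod_option, Fintype.prod_option]
  simp only [B, T, Option.elim_none, Option.elim_some, poissonMeasure_singleton,
    poissonMeasure_Ici_one, hmean, pow_zero, pow_one,
    Nat.factorial_zero, Nat.factorial_one, Nat.cast_one, mul_one, div_one]
  rw [← ENNReal.ofReal_prod_of_nonneg fun i _ => by positivity, ← ENNReal.ofReal_mul (hexp F),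
    ← ENNReal.ofReal_mul (Real.exp_pos _).le, Finset.prod_mul_distrib, ← Real.exp_sum, hvol,
    mul_add, neg_add, Real.exp_add, Finset.mul_sum, Finset.sum_neg_distrib]
  congr 1
  ring

end Counts

section Erlang

/-- The density of the `(K + 1)`-st point of a Poisson process of unit density on the half-line. -/
def erlangDensity (K : ℕ) (t : ℝ) : ℝ :=
  Real.exp (-t) * t ^ K / K !

theorem continuous_erlangDensity (K : ℕ) : Continuous (erlangDensity K) := by
  unfold erlangDensity
  fun_prop

theorem erlangDensity_nonneg (K : ℕ) {t : ℝ} (ht : 0 ≤ t) : 0 ≤ erlangDensity K t := by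
  unfold erlangDensity
  positivity

theorem integrableOn_erlangDensity (K : ℕ) {q : ℝ} (hq : 0 ≤ q) :
    IntegrableOn (erlangDensity K) (Ioi q) := by
  have h := (Real.GammaIntegral_convergent (s := (K : ℝ) + 1) (by positivity)).div_const (K ! : ℝ)
  refine IntegrableOn.mono_set (h.congr (.of_forall fun t => ?_)) (Ioi_subset_Ioi hq)
  simp only [erlangDensity, add_sub_cancel_right, Real.rpow_natCast]

theorem hasDerivAt_neg_exp_mul_sum_pow (K : ℕ) (t : ℝ) :
    HasDerivAt (fun t => -(Real.exp (-t) * ∑ l ∈ Finset.range (K + 1), t ^ l / l !))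
      (erlangDensity K t) t := by
  have hexp : HasDerivAt (fun t : ℝ => Real.exp (-t)) (-Real.exp (-t)) t := by
    simpa only [mul_neg_one] using (hasDerivAt_neg t).exp
  induction K with
  | zero => simpa [erlangDensity] using hexp.fun_neg
  | succ K ih =>
    have hpow : HasDerivAt (fun t : ℝ => t ^ (K + 1) / (K + 1)!) (t ^ K / K !) t := by
      refine ((hasDerivAt_pow (K + 1) t).div_const ((K + 1)! : ℝ)).congr_deriv ?_
      rw [Nat.factorial_succ, Nat.cast_mul, add_tsub_cancel_right,
        mul_div_mul_left _ _ (Nat.cast_ne_zero.2 K.succ_ne_zero)]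
    refine ((ih.sub (hexp.mul hpow)).congr_deriv ?_).congr_of_eventuallyEq (.of_forall fun s => ?_)
    · simp only [erlangDensity]
      ring
    · simp only [Finset.sum_range_succ _ (K + 1), Pi.sub_apply, Pi.mul_apply]
      ring

theorem integral_erlangDensity (K : ℕ) {q : ℝ} (hq : 0 ≤ q) :
    ∫ t in Ioi q, erlangDensity K t =
      Real.exp (-q) * ∑ l ∈ Finset.range (K + 1), q ^ l / l ! := by
  have hterm (l : ℕ) : Tendsto (fun t : ℝ => Real.exp (-t) * (t ^ l / l !)) atTop (𝓝 0) := by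
    have h := (Real.tendsto_pow_mul_exp_neg_atTop_nhds_zero l).div_const (l ! : ℝ)
    rw [zero_div] at h
    exact h.congr fun t => by ring
  have hlim : Tendsto (fun t : ℝ => -(Real.exp (-t) * ∑ l ∈ Finset.range (K + 1), t ^ l / l !))
      atTop (𝓝 0) := by
    simpa only [Finset.mul_sum, Finset.sum_const_zero, neg_zero] using
      (tendsto_finsetSum (Finset.range (K + 1)) fun l _ => hterm l).neg
  rw [integral_Ioi_of_hasDerivAt_of_tendsto' (fun t _ => hasDerivAt_neg_exp_mul_sum_pow K t)
    (integrableOn_erlangDensity K hq) hlim, zero_sub, neg_neg]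

theorem lintegral_erlangDensity (K : ℕ) :
    ∫⁻ t in Ioi 0, ENNReal.ofReal (erlangDensity K t) = 1 := by
  rw [← ofReal_integral_eq_lintegral_ofReal (integrableOn_erlangDensity K le_rfl)
    (ae_restrict_of_forall_mem measurableSet_Ioi fun t ht => erlangDensity_nonneg K (le_of_lt ht)),
    integral_erlangDensity K le_rfl, Finset.sum_range_succ']
  simp

end Erlang

section ArrivalMeasure

variable {n : ℕ}

/-- The measure with density `e ^ (-t)` on the line. -/
def expWeight : Measure ℝ :=
  volume.withDensity fun t => ENNReal.ofReal (Real.exp (-t))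

instance : IsLocallyFiniteMeasure expWeight :=
  .withDensity_ofReal (by fun_prop)

theorem expWeight_Ioc {c d : ℝ} (h : c ≤ d) :
    expWeight (Ioc c d) = ENNReal.ofReal (Real.exp (-c) - Real.exp (-d)) := by
  have hint : IntegrableOn (fun t => Real.exp (-t)) (Ioc c d) :=
    (Continuous.integrableOn_Icc (by fun_prop)).mono_set Ioc_subset_Icc_self
  rw [expWeight, withDensity_apply _ measurableSet_Ioc,
    ← ofReal_integral_eq_lintegral_ofReal hint (.of_forall fun t => (Real.exp_pos _).le),
    ← intervalIntegral.integral_of_le h, intervalIntegral.integral_comp_neg (fun t => Real.exp t),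
    integral_exp]

/-- The factors of `arrivalMeasure`: Lebesgue measure for the first `n` points and `expWeight` for
the last one. -/
def arrivalWeight (n : ℕ) : Fin (n + 1) → Measure ℝ :=
  Fin.snoc (α := fun _ => Measure ℝ) (fun _ => volume) expWeight

theorem arrivalWeight_castSucc (i : Fin n) : arrivalWeight n i.castSucc = volume :=
  Fin.snoc_castSucc (α := fun _ => Measure ℝ) ..

theorem arrivalWeight_last : arrivalWeight n (Fin.last n) = expWeight :=
  Fin.snoc_last (α := fun _ => Measure ℝ) ..

instance (i : Fin (n + 1)) : IsLocallyFiniteMeasure (arrivalWeight n i) := by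
  cases i using Fin.lastCases with
  | last => rw [arrivalWeight_last]; infer_instance
  | cast i => rw [arrivalWeight_castSucc]; infer_instance

/-- The measure on `ℝ ^ (n + 1)` whose restriction to increasing positive sequences is the joint law
of the first `n + 1` points of a Poisson process of unit density on the half-line. -/
def arrivalMeasure (n : ℕ) : Measure (Fin (n + 1) → ℝ) :=
  Measure.pi (arrivalWeight n)

theorem arrivalMeasure_pi_Ioc {a b : Fin (n + 1) → ℝ} (hab : ∀ i, a i ≤ b i) :
    arrivalMeasure n (univ.pi fun i => Ioc (a i) (b i)) =
      ENNReal.ofReal ((∏ i : Fin n, (b i.castSucc - a i.castSucc)) *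
        (Real.exp (-a (Fin.last n)) - Real.exp (-b (Fin.last n)))) := by
  have hnonneg (i : Fin n) : 0 ≤ b i.castSucc - a i.castSucc := sub_nonneg.2 (hab _)
  simp only [arrivalMeasure, Measure.pi_pi, Fin.prod_univ_castSucc, arrivalWeight_castSucc,
    arrivalWeight_last, Real.volume_Ioc, expWeight_Ioc (hab _)]
  rw [ENNReal.ofReal_mul (Finset.prod_nonneg fun i _ => hnonneg i),
    ENNReal.ofReal_prod_of_nonneg fun i _ => hnonneg i]

theorem arrivalMeasure_apply {s : Set (Fin (n + 1) → ℝ)} (hs : MeasurableSet s) :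
    arrivalMeasure n s =
      ∫⁻ t, ENNReal.ofReal (Real.exp (-t)) * volume {u : Fin n → ℝ | Fin.snoc u t ∈ s} := by
  have hmp := measurePreserving_piFinSuccAbove (arrivalWeight n) (Fin.last n)
  have hs' := (MeasurableEquiv.piFinSuccAbove (fun _ => ℝ) (Fin.last n)).symm.measurable hs
  simp only [Fin.succAbove_last, arrivalWeight_castSucc, arrivalWeight_last] at hmp
  rw [arrivalMeasure, ← hmp.symm.measure_preimage_equiv, Measure.prod_apply hs', expWeight,
    lintegral_withDensity_eq_lintegral_mul _ (by fun_prop) (measurable_measure_prodMk_left hs')]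
  refine lintegral_congr fun t => ?_
  have hpre : Prod.mk t ⁻¹' ((MeasurableEquiv.piFinSuccAbove (fun _ => ℝ) (Fin.last n)).symm ⁻¹' s)
      = {u : Fin n → ℝ | Fin.snoc u t ∈ s} := by
    ext u
    rw [mem_preimage, mem_preimage, MeasurableEquiv.piFinSuccAbove_symm_apply, mem_ofPred_eq,
      Fin.insertNthEquiv, Equiv.coe_fn_mk, Fin.insertNth_last']
  rw [Pi.mul_apply, hpre, volume_pi]

theorem pi_eq_of_Iic {ι : Type*} [Fintype ι] {μ : ι → Measure ℝ} [∀ i, IsFiniteMeasure (μ i)]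
    {ν : Measure (ι → ℝ)}
    (h : ∀ e : ι → ℝ, ν (univ.pi fun i => Iic (e i)) = ∏ i, μ i (Iic (e i))) :
    Measure.pi μ = ν := by
  have hspan (i) : (μ i).FiniteSpanningSetsIn (range Iic) :=
    ⟨fun k => Iic (k : ℝ), fun k => ⟨_, rfl⟩, fun _ => measure_lt_top _ _,
      eq_univ_of_forall fun x => mem_iUnion.2 (exists_nat_ge x)⟩
  refine Measure.pi_eq_generateFrom
    (fun _ => (borel_eq_generateFrom_Iic ℝ).symm.trans BorelSpace.measurable_eq.symm)
    (fun _ => isPiSystem_Iic) hspan fun s hs => ?_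
  choose e he using hs
  obtain rfl : (fun i => Iic (e i)) = s := funext he
  exact h e

end ArrivalMeasure

section Cone

variable {n : ℕ}

/-- The increasing sequences of `n + 1` positive numbers. -/
def arrivalCone (n : ℕ) : Set (Fin (n + 1) → ℝ) :=
  {p | (∀ i, 0 < p i) ∧ StrictMono p}

theorem measurableSet_strictMono : MeasurableSet {u : Fin n → ℝ | StrictMono u} := by
  simp only [StrictMono, ofPred_forall]
  exact .iInter fun i => .iInter fun j => .iInter fun _ =>
    measurableSet_lt (measurable_pi_apply _) (measurable_pi_apply _)

theorem measurableSet_arrivalCone (n : ℕ) : MeasurableSet (arrivalCone n) := by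
  have hpos : MeasurableSet {p : Fin (n + 1) → ℝ | ∀ i, 0 < p i} := by
    simp only [ofPred_forall]
    exact .iInter fun i => measurableSet_lt measurable_const (measurable_pi_apply i)
  exact hpos.inter measurableSet_strictMono

theorem strictMono_snoc_iff {u : Fin n → ℝ} {t : ℝ} :
    StrictMono (Fin.snoc u t : Fin (n + 1) → ℝ) ↔ StrictMono u ∧ ∀ i, u i < t := by
  refine ⟨fun h => ⟨fun i j hij => ?_, fun i => ?_⟩, fun ⟨hu, ht⟩ i j hij => ?_⟩
  · simpa using h (Fin.castSucc_lt_castSucc_iff.2 hij)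
  · simpa using h (Fin.castSucc_lt_last i)
  · cases i using Fin.lastCases with
    | last => exact absurd hij (Fin.le_last j).not_gt
    | cast i =>
      cases j using Fin.lastCases with
      | last => simpa using ht i
      | cast j => simpa using hu (Fin.castSucc_lt_castSucc_iff.1 hij)

theorem snoc_mem_arrivalCone_iff {u : Fin n → ℝ} {t : ℝ} :
    (Fin.snoc u t : Fin (n + 1) → ℝ) ∈ arrivalCone n ↔
      0 < t ∧ (∀ i, u i ∈ Ioo 0 t) ∧ StrictMono u := by
  simp only [arrivalCone, mem_ofPred_eq, Fin.forall_fin_succ', Fin.snoc_castSucc, Fin.snoc_last,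
    strictMono_snoc_iff, mem_Ioo, forall_and]
  tauto

theorem arrivalCone_subset (n : ℕ) : arrivalCone n ⊆
    ⋃ q : {q : Fin (n + 2) → ℚ // Monotone q ∧ 0 ≤ q 0},
      univ.pi fun i => Ioc (q.1 i.castSucc : ℝ) (q.1 i.succ) := by
  rintro p ⟨hpos, hmono⟩
  let lo : Fin (n + 2) → ℝ := Fin.cons 0 p
  let hi : Fin (n + 2) → ℝ := Fin.snoc p (p (Fin.last n) + 1)
  have hlo (i : Fin (n + 1)) : lo i.succ = p i := Fin.cons_succ (α := fun _ => ℝ) ..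
  have hhi (i : Fin (n + 1)) : hi i.castSucc = p i := Fin.snoc_castSucc (α := fun _ => ℝ) ..
  have hlt (i) : lo i < hi i := by
    cases i using Fin.cases with
    | zero => exact (hpos 0).trans_eq (hhi 0).symm
    | succ i =>
      rw [hlo]
      cases i using Fin.lastCases with
      | last => simp [hi]
      | cast i => rw [← Fin.castSucc_succ, hhi]; exact hmono Fin.castSucc_lt_succ
  choose q hq_lo hq_hi using fun i => exists_rat_btwn (hlt i)
  have hq_lt (i : Fin (n + 1)) : (q i.castSucc : ℝ) < p i := (hq_hi _).trans_eq (hhi i)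
  have hlt_q (i : Fin (n + 1)) : p i < q i.succ := (hlo i).symm.trans_lt (hq_lo _)
  have hq_mono : Monotone q := Fin.monotone_iff_le_succ.2 fun i =>
    Rat.cast_le.1 ((hq_lt i).trans (hlt_q i)).le
  have hq_nonneg : 0 ≤ q 0 := Rat.cast_nonneg.1 (hq_lo 0).le
  exact mem_iUnion.2 ⟨⟨q, hq_mono, hq_nonneg⟩, fun i _ => ⟨hq_lt i, (hlt_q i).le⟩⟩

end Cone

section Sorting

variable {n : ℕ}

theorem volume_not_injective : volume {u : Fin n → ℝ | ¬ Function.Injective u} = 0 := by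
  let diff (i j : Fin n) : (Fin n → ℝ) →ₗ[ℝ] ℝ :=
    (LinearMap.proj i : (Fin n → ℝ) →ₗ[ℝ] ℝ) - (LinearMap.proj j : (Fin n → ℝ) →ₗ[ℝ] ℝ)
  have hsub : {u : Fin n → ℝ | ¬ Function.Injective u} ⊆
      ⋃ p : {p : Fin n × Fin n // p.1 ≠ p.2}, (diff p.1.1 p.1.2).ker := by
    intro u hu
    simp only [mem_ofPred_eq, Function.Injective, not_forall] at hu
    obtain ⟨i, j, hij, hne⟩ := hu
    exact mem_iUnion.2 ⟨⟨(i, j), hne⟩, by simp [diff, hij]⟩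
  refine measure_mono_null hsub (measure_iUnion_null fun ⟨⟨i, j⟩, hij⟩ =>
    Measure.addHaar_submodule _ _ fun htop => ?_)
  have hmem : Pi.single i 1 ∈ (diff i j).ker := htop ▸ Submodule.mem_top
  simp [diff, Pi.single_eq_of_ne hij.symm] at hmem

theorem disjoint_strictMono_comp {σ τ : Equiv.Perm (Fin n)} (h : σ ≠ τ) :
    Disjoint {u : Fin n → ℝ | StrictMono (u ∘ σ)} {u | StrictMono (u ∘ τ)} := by
  refine disjoint_left.2 fun u hσ hτ => h ?_
  have hu : Function.Injective u := (Function.Injective.of_comp_iff' u σ.bijective).1 hσ.injective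
  exact Equiv.ext fun i => hu (congrFun (Tuple.unique_monotone hσ.monotone hτ.monotone) i)

theorem ae_exists_strictMono_comp : ∀ᵐ u : Fin n → ℝ, ∃ σ : Equiv.Perm (Fin n),
    StrictMono (u ∘ σ) := by
  have hinj : ∀ᵐ u : Fin n → ℝ, Function.Injective u := volume_not_injective
  filter_upwards [hinj] with u hu
  exact ⟨Tuple.sort u,
    (Tuple.monotone_sort u).strictMono_of_injective (hu.comp (Tuple.sort u).injective)⟩

theorem measurePreserving_comp_perm (σ : Equiv.Perm (Fin n)) :
    MeasurePreserving fun u : Fin n → ℝ => u ∘ σ := by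
  have hcoe : ⇑(MeasurableEquiv.piCongrLeft (fun _ => ℝ) σ.symm) = fun u : Fin n → ℝ => u ∘ σ := by
    funext u i
    simpa using MeasurableEquiv.piCongrLeft_apply_apply (β := fun _ => ℝ) σ.symm u (σ i)
  exact hcoe ▸ volume_measurePreserving_piCongrLeft (fun _ => ℝ) σ.symm

theorem volume_eq_factorial_mul {A : Set (Fin n → ℝ)} (hA : MeasurableSet A)
    (hsymm : ∀ (σ : Equiv.Perm (Fin n)) (u : Fin n → ℝ), u ∘ σ ∈ A ↔ u ∈ A) :
    volume A = n ! * volume (A ∩ {u | StrictMono u}) := by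
  have hA₁ : MeasurableSet (A ∩ {u | StrictMono u}) := hA.inter measurableSet_strictMono
  have hpre (σ : Equiv.Perm (Fin n)) : A ∩ {u | StrictMono (u ∘ σ)} =
      (· ∘ σ) ⁻¹' (A ∩ {u | StrictMono u}) := by
    ext u
    exact and_congr_left' (hsymm σ u).symm
  have hae : A =ᵐ[volume] ⋃ σ : Equiv.Perm (Fin n), A ∩ {u | StrictMono (u ∘ σ)} := by
    filter_upwards [ae_exists_strictMono_comp] with u hu
    exact propext ⟨fun h => mem_iUnion.2 (hu.imp fun σ hσ => ⟨h, hσ⟩),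
      fun h => (mem_iUnion.1 h).choose_spec.1⟩
  rw [measure_congr hae, measure_iUnion
      (fun σ τ h => (disjoint_strictMono_comp h).mono inter_subset_right inter_subset_right)
      (fun σ => hpre σ ▸ (measurePreserving_comp_perm σ).measurable hA₁), tsum_fintype]
  simp only [hpre, (measurePreserving_comp_perm _).measure_preimage hA₁.nullMeasurableSet,
    Finset.sum_const, Finset.card_univ, Fintype.card_perm, Fintype.card_fin, nsmul_eq_mul]

theorem forall_mem_Ioo_eq_univ_pi (t : ℝ) :
    {u : Fin n → ℝ | ∀ i, u i ∈ Ioo 0 t} = univ.pi fun _ => Ioo 0 t := by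
  ext u
  exact (mem_univ_pi (t := fun _ => Ioo 0 t)).symm

theorem volume_cube_inter_eq_factorial_mul {A : Set (Fin n → ℝ)} (hA : MeasurableSet A)
    (hsymm : ∀ (σ : Equiv.Perm (Fin n)) (u : Fin n → ℝ), u ∘ σ ∈ A ↔ u ∈ A) (t : ℝ) :
    volume ({u | ∀ i, u i ∈ Ioo 0 t} ∩ A) =
      n ! * volume {u | (∀ i, u i ∈ Ioo 0 t) ∧ StrictMono u ∧ u ∈ A} := by
  have hcube : MeasurableSet {u : Fin n → ℝ | ∀ i, u i ∈ Ioo 0 t} :=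
    forall_mem_Ioo_eq_univ_pi (n := n) t ▸ .univ_pi fun _ => measurableSet_Ioo
  rw [volume_eq_factorial_mul (hcube.inter hA) fun σ u => and_congr
    (σ.surjective.forall (p := fun i => u i ∈ Ioo 0 t)).symm (hsymm σ u)]
  congr 2
  ext u
  simp only [mem_inter_iff, mem_ofPred_eq]
  tauto

theorem measurable_init : Measurable (Fin.init : (Fin (n + 1) → ℝ) → Fin n → ℝ) :=
  measurable_pi_lambda _ fun i => measurable_pi_apply i.castSucc

theorem arrivalMeasure_arrivalCone_inter_preimage_init {A : Set (Fin n → ℝ)} (hA : MeasurableSet A)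
    (hsymm : ∀ (σ : Equiv.Perm (Fin n)) (u : Fin n → ℝ), u ∘ σ ∈ A ↔ u ∈ A) :
    arrivalMeasure n (arrivalCone n ∩ Fin.init ⁻¹' A) = ∫⁻ t in Ioi 0,
      ENNReal.ofReal (Real.exp (-t) / n !) * volume ({u | ∀ i, u i ∈ Ioo 0 t} ∩ A) := by
  rw [arrivalMeasure_apply ((measurableSet_arrivalCone n).inter (measurable_init hA)),
    ← lintegral_indicator measurableSet_Ioi]
  refine lintegral_congr fun t => ?_
  simp only [mem_inter_iff, mem_preimage, Fin.init_snoc, snoc_mem_arrivalCone_iff, and_assoc]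
  by_cases ht : 0 < t
  · simp only [indicator_of_mem (mem_Ioi.2 ht), ht, true_and]
    rw [volume_cube_inter_eq_factorial_mul hA hsymm, ← mul_assoc,
      ENNReal.ofReal_div_of_pos (by positivity), ENNReal.ofReal_natCast,
      ENNReal.div_mul_cancel (by exact_mod_cast n.factorial_ne_zero) (ENNReal.natCast_ne_top _)]
  · simp [ht]

theorem arrivalMeasure_arrivalCone (n : ℕ) : arrivalMeasure n (arrivalCone n) = 1 := by
  have h := arrivalMeasure_arrivalCone_inter_preimage_init (n := n) .univ fun _ _ => Iff.rfl
  rw [preimage_univ, inter_univ] at h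
  rw [h, ← lintegral_erlangDensity n]
  refine setLIntegral_congr_fun measurableSet_Ioi fun t (ht : 0 < t) => ?_
  simp only [inter_univ, forall_mem_Ioo_eq_univ_pi, Real.volume_pi_Ioo, sub_zero, Finset.prod_const,
    Finset.card_univ, Fintype.card_fin, erlangDensity]
  rw [← ENNReal.ofReal_pow ht.le, ← ENNReal.ofReal_mul (by positivity), div_mul_eq_mul_div]

end Sorting

section Law

variable {Ω : Type*} [MeasurableSpace Ω] {P : Measure Ω} {lam : ℝ} {Φ : Ω → Set Plane} {n : ℕ}

/-- The scaled distances of the first `n + 1` points. -/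
def arrivals (lam : ℝ) (n : ℕ) (S : Set Plane) (i : Fin (n + 1)) : ℝ :=
  scaledDist lam S (i + 1)

theorem measurable_arrivals (hΦ : IsHPPP P lam Φ) (n : ℕ) :
    Measurable fun ω => arrivals lam n (Φ ω) :=
  measurable_pi_lambda _ fun _ => ((measurable_nearestDist hΦ _).pow_const 2).const_mul _

theorem measure_arrivals_mem_pi_Ioc (hΦ : IsHPPP P lam Φ) (hlam : 0 < lam) {a b : Fin (n + 1) → ℝ}
    (ha : ∀ i, 0 ≤ a i) (hab : ∀ i, a i ≤ b i) (hba : ∀ i : Fin n, b i.castSucc ≤ a i.succ) :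
    P {ω | arrivals lam n (Φ ω) ∈ univ.pi fun i => Ioc (a i) (b i)} =
      arrivalMeasure n (univ.pi fun i => Ioc (a i) (b i)) := by
  let A (i : Fin (n + 1)) : Set Plane := disk lam (a i)
  let B (i : Fin (n + 1)) : Set Plane := disk lam (b i)
  have hAB (i) : A i ⊆ B i := disk_mono hlam.le (hab i)
  have hBA (i : Fin n) : B i.castSucc ⊆ A i.succ := disk_mono hlam.le (hba i)
  have hshell (i) : MeasurableSet (B i \ A i) :=
    (measurableSet_disk _ _).diff (measurableSet_disk _ _)
  have hset : {ω | arrivals lam n (Φ ω) ∈ univ.pi fun i => Ioc (a i) (b i)} =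
      {ω | (Φ ω ∩ (A (Fin.last n) \ ⋃ i : Fin n, B i.castSucc \ A i.castSucc)).ncard = 0 ∧
        (∀ i : Fin n, (Φ ω ∩ (B i.castSucc \ A i.castSucc)).ncard = 1) ∧
        1 ≤ (Φ ω ∩ (B (Fin.last n) \ A (Fin.last n))).ncard} := by
    ext ω
    rw [mem_ofPred_eq, mem_ofPred_eq, mem_univ_pi, ← ncard_interlace_iff hAB hBA
      fun i => hΦ.finite_inter ω _ (isBounded_disk _ _)]
    exact forall_congr' fun i =>
      scaledDist_mem_Ioc_iff hlam (hΦ.finite_inter ω) (ha i) ((ha i).trans (hab i))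
  rw [hset, measure_ncard_eq_one hΦ hlam.le (measurableSet_disk _ _) (isBounded_disk _ _) (hshell _)
    ((isBounded_disk _ _).subset sdiff_subset) (fun _ => hshell _)
    (iUnion_sdiff_castSucc_subset hAB hBA)
    (fun _ _ h => pairwise_disjoint_sdiff hAB hBA ((Fin.castSucc_injective n).ne h))
    disjoint_sdiff_right, arrivalMeasure_pi_Ioc hab]
  simp only [A, B, mul_measureReal_disk hlam (ha _),
    mul_measureReal_disk_sdiff hlam (ha _) (hab _)]
  rw [mul_one_sub, ← Real.exp_add, ← neg_add, add_sub_cancel]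

theorem map_arrivals_pi_Ioc (hΦ : IsHPPP P lam Φ) (hlam : 0 < lam) {a b : Fin (n + 1) → ℝ}
    (ha : ∀ i, 0 ≤ a i) (hba : ∀ i : Fin n, b i.castSucc ≤ a i.succ) :
    P.map (fun ω => arrivals lam n (Φ ω)) (univ.pi fun i => Ioc (a i) (b i)) =
      arrivalMeasure n (univ.pi fun i => Ioc (a i) (b i)) := by
  rcases (univ.pi fun i => Ioc (a i) (b i)).eq_empty_or_nonempty with hempty | ⟨p, hp⟩
  · rw [hempty, measure_empty, measure_empty]
  · rw [Measure.map_apply (measurable_arrivals hΦ n) (.univ_pi fun _ => measurableSet_Ioc)]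
    exact measure_arrivals_mem_pi_Ioc hΦ hlam ha
      (fun i => (hp i trivial).1.le.trans (hp i trivial).2) hba

theorem restrict_map_arrivals_pi_Ioc (hΦ : IsHPPP P lam Φ) (hlam : 0 < lam)
    {a b : Fin (n + 1) → ℝ} (ha : ∀ i, 0 ≤ a i) (hba : ∀ i : Fin n, b i.castSucc ≤ a i.succ) :
    (P.map fun ω => arrivals lam n (Φ ω)).restrict (univ.pi fun i => Ioc (a i) (b i)) =
      (arrivalMeasure n).restrict (univ.pi fun i => Ioc (a i) (b i)) := by
  have hfin (i) : IsFiniteMeasure ((arrivalWeight n i).restrict (Ioc (a i) (b i))) :=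
    isFiniteMeasure_restrict.2 measure_Ioc_lt_top.ne
  rw [arrivalMeasure, Measure.restrict_pi_pi]
  refine (pi_eq_of_Iic fun e => ?_).symm
  rw [Measure.restrict_apply (.univ_pi fun _ => measurableSet_Iic), inter_comm, ← pi_inter_distrib]
  simp only [Measure.restrict_apply measurableSet_Iic, inter_comm (Iic _), Ioc_inter_Iic]
  rw [map_arrivals_pi_Ioc hΦ hlam ha fun i => (min_le_left _ _).trans (hba i), arrivalMeasure,
    Measure.pi_pi]

theorem restrict_map_arrivals (hΦ : IsHPPP P lam Φ) (hlam : 0 < lam) (n : ℕ) :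
    (P.map fun ω => arrivals lam n (Φ ω)).restrict (arrivalCone n) =
      (arrivalMeasure n).restrict (arrivalCone n) := by
  refine Measure.restrict_congr_mono (arrivalCone_subset n) (Measure.restrict_iUnion_congr.2 ?_)
  rintro ⟨q, hq_mono, hq_nonneg⟩
  exact restrict_map_arrivals_pi_Ioc hΦ hlam
    (fun i => Rat.cast_nonneg.2 (hq_nonneg.trans (hq_mono (Fin.zero_le _)))) fun i => le_rfl

theorem map_arrivals [IsProbabilityMeasure P] (hΦ : IsHPPP P lam Φ) (hlam : 0 < lam) (n : ℕ) :
    P.map (fun ω => arrivals lam n (Φ ω)) = (arrivalMeasure n).restrict (arrivalCone n) := by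
  have := Measure.isProbabilityMeasure_map (μ := P) (measurable_arrivals hΦ n).aemeasurable
  have h := restrict_map_arrivals hΦ hlam n
  rw [← h, Measure.restrict_eq_self_of_ae_mem]
  refine (mem_ae_iff_prob_eq_one (measurableSet_arrivalCone n)).2 ?_
  rw [← Measure.restrict_apply_self, h, Measure.restrict_apply_self, arrivalMeasure_arrivalCone]

end Law

section Terms

variable {α c x t : ℝ} {K l : ℕ}

/-- `x (t / c) ^ (α / 2)`: with `c = λπ`, the bound `x` on `∑ r_i ^ (-α)` expressed for the ratios
`(λπ r_i ^ 2 / t) ^ (-α / 2)`, which given `λπ r_{K+1} ^ 2 = t` form a Pareto sample. -/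
def rescaledLevel (α c x t : ℝ) : ℝ := x * (t / c) ^ (α / 2)

/-- The value of `t` at which `rescaledLevel α c x t = K`, the least value of a sum of `K` Pareto
variables. -/
def threshold (α c x : ℝ) (K : ℕ) : ℝ := (K / x) ^ (2 / α) * c

theorem measurable_rescaledLevel (α c x : ℝ) : Measurable (rescaledLevel α c x) := by
  unfold rescaledLevel
  fun_prop

theorem threshold_nonneg (α : ℝ) (hc : 0 ≤ c) (hx : 0 ≤ x) (K : ℕ) : 0 ≤ threshold α c x K := by
  unfold threshold
  positivity

theorem natCast_lt_rescaledLevel_iff (hα : 0 < α) (hc : 0 < c) (hx : 0 < x) (ht : 0 ≤ t) :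
    (K : ℝ) < rescaledLevel α c x t ↔ threshold α c x K < t := by
  rw [rescaledLevel, threshold, ← div_lt_iff₀' hx, ← lt_div_iff₀ hc, ← inv_div 2 α,
    Real.lt_rpow_inv_iff_of_pos (by positivity) (by positivity) (by positivity)]

theorem rescaledLevel_lt_natCast_iff (hα : 0 < α) (hc : 0 < c) (hx : 0 < x) (ht : 0 ≤ t) :
    rescaledLevel α c x t < K ↔ t < threshold α c x K := by
  rw [rescaledLevel, threshold, ← lt_div_iff₀' hx, ← div_lt_iff₀ hc, ← inv_div 2 α,
    Real.rpow_inv_lt_iff_of_pos (by positivity) (by positivity) (by positivity)]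

theorem erlangDensity_mul_paretoTerm (hα : α ≠ 0) (hc : 0 < c) (hx : 0 ≤ x) (m : ℕ) (ht : 0 < t) :
    erlangDensity K t * paretoTerm α K l (rescaledLevel α c x t) m =
      coeffA α (K - l) m * Real.Gamma (m + 2 / α * l) * x ^ (-(m : ℝ) - 2 / α * l) *
        (1 / K !) * c ^ (1 / 2 * m * α + l) *
        (t ^ ((K : ℝ) - m * α / 2 - l + 1 - 1) * Real.exp (-t)) := by
  have hexp : α / 2 * (-(m : ℝ) - 2 / α * l) = -(1 / 2 * m * α + l) := by
    field_simp
    ring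
  have hpow : (t / c) ^ (-(1 / 2 * m * α + l)) =
      c ^ (1 / 2 * m * α + l) * t ^ (-(1 / 2 * m * α + l)) := by
    rw [Real.div_rpow ht.le hc.le, Real.rpow_neg hc.le, div_inv_eq_mul, mul_comm]
  have hsum : (K : ℝ) - m * α / 2 - l + 1 - 1 = K + -(1 / 2 * m * α + l) := by ring
  rw [erlangDensity, paretoTerm, rescaledLevel, Real.mul_rpow hx (by positivity),
    ← Real.rpow_mul (by positivity), hexp, hpow, hsum, Real.rpow_add ht, Real.rpow_natCast]
  ring

theorem integral_erlangDensity_mul_paretoTerm {lam : ℝ} (hα : α ≠ 0) (hlam : 0 < lam) (hx : 0 ≤ x)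
    (m : ℕ) :
    ∫ t in Ioi (threshold α (lam * π) x K),
      erlangDensity K t * paretoTerm α K l (rescaledLevel α (lam * π) x t) m =
        cdfTerm α lam K x l m := by
  have hc : 0 < lam * π := by positivity
  rw [cdfTerm, upperGamma, ← integral_const_mul, mul_assoc _ lam, ← threshold]
  exact setIntegral_congr_fun measurableSet_Ioi fun t ht =>
    erlangDensity_mul_paretoTerm hα hc hx m ((threshold_nonneg α hc.le hx K).trans_lt ht)

theorem norm_paretoTerm_le (hα : 0 ≤ α) (hK : 0 < K) {y : ℝ} (hy : (K : ℝ) ≤ y) (m : ℕ) :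
    ‖paretoTerm α K l y m‖ ≤ ‖paretoTerm α K l K m‖ := by
  have hK0 : (0 : ℝ) < K := by exact_mod_cast hK
  have hexp : -(m : ℝ) - 2 / α * l ≤ 0 := by
    rw [← neg_add', neg_nonpos]
    positivity
  simp only [paretoTerm, norm_mul, Real.norm_rpow_of_nonneg, hK0.le, hK0.le.trans hy]
  gcongr ?_ * ?_
  exact Real.rpow_le_rpow_of_nonpos (norm_pos_iff.2 hK0.ne')
    (by rwa [Real.norm_of_nonneg hK0.le, Real.norm_of_nonneg (hK0.le.trans hy)]) hexp

theorem norm_erlangDensity_mul_paretoTerm_le (hα : 0 < α) (hc : 0 < c) (hx : 0 < x) (hK : 0 < K)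
    (m : ℕ) (ht : threshold α c x K < t) :
    ‖erlangDensity K t * paretoTerm α K l (rescaledLevel α c x t) m‖ ≤
      erlangDensity K t * ‖paretoTerm α K l K m‖ := by
  have ht0 : 0 ≤ t := (threshold_nonneg α hc.le hx.le K).trans ht.le
  rw [norm_mul, Real.norm_of_nonneg (erlangDensity_nonneg K ht0)]
  exact mul_le_mul_of_nonneg_left
    (norm_paretoTerm_le hα.le hK ((natCast_lt_rescaledLevel_iff hα hc hx ht0).2 ht).le m)
    (erlangDensity_nonneg K ht0)

theorem measurable_erlangDensity_mul_paretoTerm (α c x : ℝ) (K l m : ℕ) :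
    Measurable fun t => erlangDensity K t * paretoTerm α K l (rescaledLevel α c x t) m :=
  (continuous_erlangDensity K).measurable.mul
    (((measurable_rescaledLevel α c x).pow_const _).const_mul _)

theorem integrableOn_erlangDensity_mul_paretoTerm (hα : 0 < α) (hc : 0 < c) (hx : 0 < x)
    (hK : 0 < K) (m : ℕ) :
    IntegrableOn (fun t => erlangDensity K t * paretoTerm α K l (rescaledLevel α c x t) m)
      (Ioi (threshold α c x K)) :=
  ((integrableOn_erlangDensity K (threshold_nonneg α hc.le hx.le K)).mul_const _).mono'
    (measurable_erlangDensity_mul_paretoTerm α c x K l m).aestronglyMeasurable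
    (ae_restrict_of_forall_mem measurableSet_Ioi fun _ =>
      norm_erlangDensity_mul_paretoTerm_le hα hc hx hK m)

theorem summable_integral_norm_erlangDensity_mul_paretoTerm (hα : 2 < α) (hc : 0 < c) (hx : 0 < x)
    (hl : l ≠ 0) (hlK : l ≤ K) :
    Summable fun m : ℕ => ∫ t in Ioi (threshold α c x K),
      ‖erlangDensity K t * paretoTerm α K l (rescaledLevel α c x t) m‖ := by
  have hα0 : 0 < α := by linarith
  have hK : 0 < K := (Nat.pos_of_ne_zero hl).trans_le hlK
  refine .of_nonneg_of_le (fun m => integral_nonneg fun _ => norm_nonneg _) (fun m => ?_)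
    ((summable_norm_paretoTerm hα hl hlK le_rfl).mul_left
      (∫ t in Ioi (threshold α c x K), erlangDensity K t))
  rw [← integral_mul_const]
  exact setIntegral_mono_on (integrableOn_erlangDensity_mul_paretoTerm hα0 hc hx hK m).norm
    ((integrableOn_erlangDensity K (threshold_nonneg α hc.le hx.le K)).mul_const _)
    measurableSet_Ioi fun t => norm_erlangDensity_mul_paretoTerm_le hα0 hc hx hK m

theorem summable_cdfTerm {lam : ℝ} (hα : 2 < α) (hlam : 0 < lam) (hx : 0 < x) (hl : l ≠ 0)
    (hlK : l ≤ K) : Summable fun m : ℕ => cdfTerm α lam K x l m := by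
  have hα0 : α ≠ 0 := by positivity
  refine .of_norm_bounded (summable_integral_norm_erlangDensity_mul_paretoTerm hα
    (mul_pos hlam Real.pi_pos) hx hl hlK) fun m => ?_
  rw [← integral_erlangDensity_mul_paretoTerm hα0 hlam hx.le]
  exact norm_integral_le_integral_norm _

theorem integrableOn_erlangDensity_mul_tsum_paretoTerm (hα : 2 < α) (hc : 0 < c) (hx : 0 < x)
    (hl : l ≠ 0) (hlK : l ≤ K) :
    IntegrableOn (fun t => erlangDensity K t * ∑' m, paretoTerm α K l (rescaledLevel α c x t) m)
      (Ioi (threshold α c x K)) := by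
  have hα0 : 0 < α := by linarith
  have hK : 0 < K := (Nat.pos_of_ne_zero hl).trans_le hlK
  have hsum := summable_norm_paretoTerm hα hl hlK le_rfl
  simp only [← tsum_mul_left]
  refine ((integrableOn_erlangDensity K (threshold_nonneg α hc.le hx.le K)).mul_const
    (∑' m, ‖paretoTerm α K l K m‖)).mono' (Measurable.tsum fun m =>
      measurable_erlangDensity_mul_paretoTerm α c x K l m).aestronglyMeasurable
    (ae_restrict_of_forall_mem measurableSet_Ioi fun t ht => ?_)
  exact tsum_of_norm_bounded (hsum.hasSum.mul_left _) fun m =>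
    norm_erlangDensity_mul_paretoTerm_le hα0 hc hx hK m ht

theorem integral_erlangDensity_mul_tsum_paretoTerm {lam : ℝ} (hα : 2 < α) (hlam : 0 < lam)
    (hx : 0 < x) (hl : l ≠ 0) (hlK : l ≤ K) :
    ∫ t in Ioi (threshold α (lam * π) x K),
      erlangDensity K t * ∑' m, paretoTerm α K l (rescaledLevel α (lam * π) x t) m =
        ∑' m, cdfTerm α lam K x l m := by
  have hα0 : 0 < α := by linarith
  have hc : 0 < lam * π := by positivity
  have hK : 0 < K := (Nat.pos_of_ne_zero hl).trans_le hlK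
  simp only [← tsum_mul_left, ← integral_erlangDensity_mul_paretoTerm hα0.ne' hlam hx.le]
  exact (integral_tsum_of_summable_integral_norm
    (integrableOn_erlangDensity_mul_paretoTerm hα0 hc hx hK)
    (summable_integral_norm_erlangDensity_mul_paretoTerm hα hc hx hl hlK)).symm

theorem integral_erlangDensity_mul_paretoCDF_Ioi_threshold {lam : ℝ} (hα : 2 < α) (hlam : 0 < lam)
    (hx : 0 < x) (K : ℕ) :
    ∫ t in Ioi (threshold α (lam * π) x K),
      erlangDensity K t * paretoCDF α K (rescaledLevel α (lam * π) x t) =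
        cdfFormula α lam K x := by
  have hα0 : 0 < α := by linarith
  have hc : 0 < lam * π := by positivity
  have hq := threshold_nonneg α hc.le hx.le K
  let w (l : ℕ) : ℝ := K.choose l * (-Real.Gamma (1 - 2 / α)) ^ l * Real.sin (2 * π * l / α)
  have hseries : ∀ t ∈ Ioi (threshold α (lam * π) x K),
      erlangDensity K t * paretoCDF α K (rescaledLevel α (lam * π) x t) = erlangDensity K t +
        1 / π * ∑ l ∈ Finset.Icc 1 K, w l *
          (erlangDensity K t * ∑' m, paretoTerm α K l (rescaledLevel α (lam * π) x t) m) := by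
    intro t ht
    rw [paretoCDF_eq hα ((natCast_lt_rescaledLevel_iff hα0 hc hx (hq.trans ht.le)).2 ht), mul_add,
      mul_one, mul_left_comm, Finset.mul_sum]
    simp only [w, mul_left_comm (erlangDensity K t)]
  have hint : ∀ l ∈ Finset.Icc 1 K, IntegrableOn (fun t => w l * (erlangDensity K t *
      ∑' m, paretoTerm α K l (rescaledLevel α (lam * π) x t) m)) (Ioi (threshold α _ x K)) :=
    fun l hl => (integrableOn_erlangDensity_mul_tsum_paretoTerm hα hc hx
      (Nat.ne_zero_of_lt (Finset.mem_Icc.1 hl).1) (Finset.mem_Icc.1 hl).2).const_mul _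
  rw [setIntegral_congr_fun measurableSet_Ioi hseries, integral_add
      (integrableOn_erlangDensity K hq) ((integrable_finsetSum _ hint).const_mul _),
    integral_const_mul, integral_finsetSum _ hint, integral_erlangDensity K hq, cdfFormula,
    threshold, mul_comm (lam * π)]
  congr 2
  refine Finset.sum_congr rfl fun l hl => ?_
  rw [integral_const_mul, ← threshold, integral_erlangDensity_mul_tsum_paretoTerm hα hlam hx
    (Nat.ne_zero_of_lt (Finset.mem_Icc.1 hl).1) (Finset.mem_Icc.1 hl).2]

theorem integral_erlangDensity_mul_paretoCDF {lam : ℝ} (hα : 2 < α) (hlam : 0 < lam) (hx : 0 < x)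
    (K : ℕ) :
    ∫ t in Ioi 0, erlangDensity K t * paretoCDF α K (rescaledLevel α (lam * π) x t) =
      cdfFormula α lam K x := by
  have hα0 : 0 < α := by linarith
  have hc : 0 < lam * π := by positivity
  rw [← integral_erlangDensity_mul_paretoCDF_Ioi_threshold hα hlam hx]
  refine setIntegral_eq_of_subset_of_ae_sdiff_eq_zero measurableSet_Ioi.nullMeasurableSet
    (Ioi_subset_Ioi (threshold_nonneg α hc.le hx.le K)) ?_
  filter_upwards [Measure.ae_ne volume (threshold α (lam * π) x K)] with t hne ht
  rw [paretoCDF_of_lt α ((rescaledLevel_lt_natCast_iff hα0 hc hx (mem_Ioi.1 ht.1).le).2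
    ((not_lt.1 ht.2).lt_of_ne hne)), mul_zero]

end Terms

section Law

variable {Ω : Type*} [MeasurableSpace Ω] {P : Measure Ω} [IsProbabilityMeasure P] {lam α x : ℝ}
  {Φ : Ω → Set Plane} {K : ℕ}

theorem pathLossSum_eq (α : ℝ) (hlam : 0 < lam) (K : ℕ) (S : Set Plane) :
    pathLossSum α K S =
      (lam * π) ^ (α / 2) * ∑ i, Fin.init (arrivals lam K S) i ^ (-(α / 2)) := by
  have hc : 0 < lam * π := by positivity
  rw [pathLossSum, ← Finset.Ico_add_one_right_eq_Icc, Finset.sum_Ico_eq_sum_range,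
    Nat.add_sub_cancel, ← Fin.sum_univ_eq_sum_range (fun i => nearestDist S (1 + i) ^ (-α)),
    Finset.mul_sum]
  refine Finset.sum_congr rfl fun i _ => ?_
  have hr := nearestDist_nonneg S (i + 1)
  change _ = _ * (lam * π * nearestDist S (i + 1) ^ 2) ^ (-(α / 2))
  rw [Real.mul_rpow hc.le (by positivity), ← mul_assoc, ← Real.rpow_add hc,
    add_neg_cancel, Real.rpow_zero, one_mul, ← Real.rpow_natCast, ← Real.rpow_mul hr, add_comm]
  congr 1
  push_cast
  ring

theorem measure_pathLossSum_le (hΦ : IsHPPP P lam Φ) (hlam : 0 < lam) (hα : 0 < α) (K : ℕ)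
    (x : ℝ) : P {ω | pathLossSum α K (Φ ω) ≤ x} = ∫⁻ t in Ioi 0,
      ENNReal.ofReal (erlangDensity K t * paretoCDF α K (rescaledLevel α (lam * π) x t)) := by
  have hc : 0 < (lam * π) ^ (α / 2) := by positivity
  let A : Set (Fin K → ℝ) := {u | ∑ i, u i ^ (-(α / 2)) ≤ x / (lam * π) ^ (α / 2)}
  have hA : MeasurableSet A := measurableSet_le (by fun_prop) measurable_const
  have hsymm (σ : Equiv.Perm (Fin K)) (u : Fin K → ℝ) : u ∘ σ ∈ A ↔ u ∈ A := by
    simp only [A, mem_ofPred_eq, Function.comp_apply]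
    rw [Equiv.sum_comp σ fun i => u i ^ (-(α / 2))]
  have hset : {ω | pathLossSum α K (Φ ω) ≤ x} =
      (fun ω => arrivals lam K (Φ ω)) ⁻¹' (Fin.init ⁻¹' A) := by
    ext ω
    simp only [mem_ofPred_eq, mem_preimage, A]
    rw [pathLossSum_eq α hlam, le_div_iff₀' hc]
  rw [hset, ← Measure.map_apply (measurable_arrivals hΦ K) (measurable_init hA),
    map_arrivals hΦ hlam, Measure.restrict_apply (measurable_init hA), inter_comm,
    arrivalMeasure_arrivalCone_inter_preimage_init hA hsymm]
  refine setLIntegral_congr_fun measurableSet_Ioi fun t (ht : 0 < t) => ?_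
  have hlevel : x / (lam * π) ^ (α / 2) * t ^ (α / 2) = rescaledLevel α (lam * π) x t := by
    rw [rescaledLevel, Real.div_rpow ht.le (by positivity), div_mul_eq_mul_div, mul_div_assoc]
  rw [← ofPred_and, volume_cube_sum_rpow_le hα ht, hlevel, ← ENNReal.ofReal_mul (by positivity),
    erlangDensity, ← mul_assoc, div_mul_eq_mul_div]

theorem monotone_paretoCDF (hα : 0 ≤ α) (K : ℕ) : Monotone (paretoCDF α K) := fun _ _ hyz =>
  mul_le_mul_of_nonneg_left (measureReal_mono (Iic_subset_Iic.2 hyz)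
    (IsLocFiniteNonneg.measure_Iic_ne_top _)) (by positivity)

theorem paretoCDF_nonneg (hα : 0 ≤ α) (K : ℕ) (y : ℝ) : 0 ≤ paretoCDF α K y :=
  mul_nonneg (by positivity) measureReal_nonneg

theorem measureReal_pathLossSum_le (hΦ : IsHPPP P lam Φ) (hlam : 0 < lam) (hα : 0 < α) (K : ℕ)
    (x : ℝ) : P.real {ω | pathLossSum α K (Φ ω) ≤ x} =
      ∫ t in Ioi 0, erlangDensity K t * paretoCDF α K (rescaledLevel α (lam * π) x t) := by
  rw [measureReal_def, measure_pathLossSum_le hΦ hlam hα, integral_eq_lintegral_of_nonneg_ae]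
  · exact ae_restrict_of_forall_mem measurableSet_Ioi fun t ht =>
      mul_nonneg (erlangDensity_nonneg K (mem_Ioi.1 ht).le) (paretoCDF_nonneg hα.le K _)
  · exact ((continuous_erlangDensity K).measurable.mul ((monotone_paretoCDF hα.le K).measurable.comp
      (measurable_rescaledLevel α _ x))).aestronglyMeasurable

theorem measureReal_pathLossSum_le_eq_cdfFormula (hΦ : IsHPPP P lam Φ) (hlam : 0 < lam)
    (hα : 2 < α) (K : ℕ) (hx : 0 < x) :
    P.real {ω | pathLossSum α K (Φ ω) ≤ x} = cdfFormula α lam K x := by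
  rw [measureReal_pathLossSum_le hΦ hlam (by linarith),
    integral_erlangDensity_mul_paretoCDF hα hlam hx]

theorem measureReal_pathLossSum_le_of_nonpos (hΦ : IsHPPP P lam Φ) (hlam : 0 < lam) (hα : 0 < α)
    (hK : 0 < K) (hx : x ≤ 0) : P.real {ω | pathLossSum α K (Φ ω) ≤ x} = 0 := by
  rw [measureReal_pathLossSum_le hΦ hlam hα]
  refine setIntegral_eq_zero_of_forall_eq_zero fun t (ht : 0 < t) => ?_
  have hlevel : rescaledLevel α (lam * π) x t ≤ 0 :=
    mul_nonpos_of_nonpos_of_nonneg hx (by positivity)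
  rw [paretoCDF_of_lt α (hlevel.trans_lt (by exact_mod_cast hK)), mul_zero]

end Law

end CoopBS

end

theorem mainTheorem3 {Ω : Type*} [MeasurableSpace Ω] (P : Measure Ω) [IsProbabilityMeasure P]
    (lam α : ℝ) (hlam : 0 < lam) (hα : 2 < α) (K L : ℕ) (hK : 1 ≤ K) (hL : 1 ≤ L)
    (Φ : Ω → Set CoopBS.Plane) (hΦ : CoopBS.IsHPPP P lam Φ) :
    Measurable (fun ω => CoopBS.receivedPower α L K (Φ ω)) ∧
    (∀ x : ℝ, cdf (P.map (fun ω => CoopBS.receivedPower α L K (Φ ω))) x =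
      P.real {ω | CoopBS.pathLossSum α K (Φ ω) ≤ x / (L : ℝ)}) ∧
    (∀ x : ℝ, 0 < x →
      (∀ l ∈ Finset.Icc 1 K, Summable (fun m : ℕ => CoopBS.cdfTerm α lam K x l m)) ∧
      P.real {ω | CoopBS.pathLossSum α K (Φ ω) ≤ x} = CoopBS.cdfFormula α lam K x) ∧
    (∀ x : ℝ, x ≤ 0 → P.real {ω | CoopBS.pathLossSum α K (Φ ω) ≤ x} = 0) := by
  have hmeas : Measurable fun ω => CoopBS.receivedPower α L K (Φ ω) :=
    (CoopBS.measurable_pathLossSum hΦ α K).const_mul _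
  have hL_pos : (0 : ℝ) < L := by exact_mod_cast hL
  refine ⟨hmeas, fun x => ?_, fun x hx => ⟨fun l hl => ?_, ?_⟩, fun x hx => ?_⟩
  · have := Measure.isProbabilityMeasure_map (μ := P) hmeas.aemeasurable
    rw [cdf_eq_real, map_measureReal_apply hmeas measurableSet_Iic]
    congr 1
    ext ω
    simp only [Set.mem_preimage, Set.mem_Iic, Set.mem_ofPred_eq, CoopBS.receivedPower]
    rw [le_div_iff₀' hL_pos]
  · obtain ⟨hl_pos, hlK⟩ := Finset.mem_Icc.1 hl
    exact CoopBS.summable_cdfTerm hα hlam hx (Nat.ne_zero_of_lt hl_pos) hlK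
  · exact CoopBS.measureReal_pathLossSum_le_eq_cdfFormula hΦ hlam hα K hx
  · exact CoopBS.measureReal_pathLossSum_le_of_nonpos hΦ hlam (by linarith) hK hx
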